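/- Let $\{G_n\}_{n\in\omega}$ be a sequence of groups, regarded as having the same identity $1$ and otherwise pairwise disjoint. A \emph{word} is a map $W:\overline W\to\bigcup_n G_n$ on a totally ordered set $\overline W$ such that $\{i: W(i)\in G_n\}$ is finite for each $n$; we write $V\equiv W$ if there is a letter-preserving order isomorphism $\overline V\to\overline W$. Words are concatenated in the obvious way, $E$ is the empty word, and $W^{-1}$ has the reversed domain and inverted letters. Let $p_N(W)$ be the finite word of those letters of $W$ lying in $G_0\cup\dots\cup G_N$, and write $V\sim W$ if for every $N$ the words $p_N(V)$, $p_N(W)$ represent the same element of the free product $*_{n\le N}G_n$. A \emph{subword} of $W$ is a restriction $W\upharpoonright I$ to an interval $I$ (convex subset) of $\overline W$, up to $\equiv$. A word is \emph{reduced} if no nonempty subword is $\sim E$ and no two neighbouring letters lie in a common $G_n$. Every $\sim$-class contains exactly one reduced word up to $\equiv$, so the group of words modulo $\sim$ under concatenation (the topologist's product) is identified with the group $\mathrm{Red}(\{G_n\})$ of reduced words. Let $\mathcal A(\{G_n\})$ be the quotient of this group by the normal closure of the subgroup $*_nG_n$ of elements represented by finite words, $\beth$ the quotient homomorphism, and $[[W]]$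 the image of a word $W$. For a family $\{W_x\}_{x\in X}$ of reduced words, $\mathrm{Fine}(\{W_x\})$ is the subgroup of $\mathrm{Red}(\{G_n\})$ generated by all subwords of the $W_x$. A subset $\Lambda_0$ of a totally ordered set $\Lambda$ is \emph{close} in $\Lambda$ if it meets every infinite interval of $\Lambda$. A \emph{close order isomorphism} (coi) $\iota$ from $\Lambda$ to $\Theta$ is an order isomorphism from a close subset $\Lambda_0$ of $\Lambda$ onto a close subset $\Theta_0$ of $\Theta$; then $\iota^{-1}$ is a coi from $\Theta$ to $\Lambda$. For an interval $I\subseteq\Lambda$ let $\varpropto(I,\iota)$ be the smallest interval of $\Theta$ containing $\iota(I\cap\Lambda_0)$. Let $\{K_n\}_{n\in\omega}$ be a second sequence of groups. A \emph{coi triple} $\mathrm{coi}(W,\iota,U)$ consists of reduced words $W\in\mathrm{Red}(\{G_n\})$, $U\in\mathrm{Red}(\{K_n\})$ and a coi $\iota$ from $\overline W$ to $\overline U$. A collection $\{\mathrm{coi}(W_x,\iota_x,U_x)\}_{x\in X}$ is \emph{coherent} if for all $x,y\in X$, intervals $I\subseteq\overline{W_x}$, $J\subseteq\overline{W_y}$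 and $\delta\in\{1,-1\}$ with $W_x\upharpoonright I\equiv(W_y\upharpoonright J)^\delta$ one has $[[U_x\upharpoonright\varpropto(I,\iota_x)]]=[[(U_y\upharpoonright\varpropto(J,\iota_y))^\delta]]$, and the same holds for the collection $\{\mathrm{coi}(U_x,\iota_x^{-1},W_x)\}_{x\in X}$. \textbf{Theorem.} Let $\{\mathrm{coi}(W_x,\iota_x,U_x)\}_{x\in X}$ be a coherent collection of coi triples from $\mathrm{Red}(\{G_n\})$ to $\mathrm{Red}(\{K_n\})$. There is a well-defined homomorphism $\phi_0:\mathrm{Fine}(\{W_x\})\to\mathcal A(\{K_n\})$ whose value at a reduced word $W$ is computed as follows. Write $W$ as a finite concatenation $V_0V_1\cdots V_k$ in which each factor is either a nonempty subword of some $W_x$ or $W_x^{-1}$, or a one-letter word whose letter is an element of some $G_n\setminus\{1\}$ that is a product of elements of $G_n$ occurring as letters of the words $W_x$, $W_x^{-1}$ (the empty word is the empty concatenation). Omit the factors of length one, write each remaining factor as $(W_x\upharpoonright I)^{\delta}$ with $x\in X$, $I$ an interval of $\overline{W_x}$ and $\delta\in\{1,-1\}$, and let $\phi_0(W)$ be the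 product, in order, of the corresponding elements $[[(U_x\upharpoonright\varpropto(I,\iota_x))^{\delta}]]$. Such a decomposition exists for every $W\in\mathrm{Fine}(\{W_x\})$, and the result does not depend on any of the choices. Symmetrically, the collection $\{\mathrm{coi}(U_x,\iota_x^{-1},W_x)\}_{x\in X}$ gives a well-defined homomorphism $\phi_1:\mathrm{Fine}(\{U_x\})\to\mathcal A(\{G_n\})$. Moreover $\phi_0$ and $\phi_1$ descend to isomorphisms $$\Phi_0:\beth(\mathrm{Fine}(\{W_x\}))\to\beth(\mathrm{Fine}(\{U_x\})),\qquad \Phi_1:\beth(\mathrm{Fine}(\{U_x\}))\to\beth(\mathrm{Fine}(\{W_x\})),$$ that is, $\Phi_0(\beth(W))=\phi_0(W)$ and $\Phi_1(\beth(U))=\phi_1(U)$ for all $W\in\mathrm{Fine}(\{W_x\})$ and $U\in\mathrm{Fine}(\{U_x\})$, and $\Phi_1=\Phi_0^{-1}$. -/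

import Mathlib

universe u v w

noncomputable section

namespace InfiniteWords

/-! ## Words

The groups `G n` are regarded as subgroups of one group, meeting pairwise only in the identity, by
realising them inside the free product `Monoid.CoprodI G`. -/

/-- The copy of `G n` in the free product. -/
def grp (G : ℕ → Type u) [∀ n, Group (G n)] (n : ℕ) : Subgroup (Monoid.CoprodI G) :=
  (Monoid.CoprodI.of : G n →* Monoid.CoprodI G).range

/-- A word: a map from a totally ordered set to the union of the groups, taking values in each
`G n` only finitely often. The domain is then countable, so that taking it in the lowest universe
loses nothing. -/
structure Word (G : ℕ → Type u) [∀ n, Group (G n)] where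
  /-- the domain of the word -/
  Idx : Type
  [order : LinearOrder Idx]
  /-- the letters of the word -/
  letter : Idx → Monoid.CoprodI G
  isLetter : ∀ i, ∃ n, letter i ∈ grp G n
  finite_fiber : ∀ n, {i | letter i ∈ grp G n}.Finite

attribute [instance] Word.order

namespace Word

variable {G : ℕ → Type u} [∀ n, Group (G n)]

/-- Sameness `V ≡ W` of words: an order isomorphism of the domains preserving the letters. -/
def Equiv (V W : Word G) : Prop :=
  ∃ e : V.Idx ≃o W.Idx, ∀ i, W.letter (e i) = V.letter i

/-- The empty word `E`. -/
def empty (G : ℕ → Type u) [∀ n, Group (G n)] : Word G where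
  Idx := Empty
  letter := Empty.elim
  isLetter := fun i => i.elim
  finite_fiber := fun _ => Set.toFinite _

/-- The concatenation of two words. -/
def concat (V W : Word G) : Word G where
  Idx := V.Idx ⊕ₗ W.Idx
  letter := fun i => Sum.elim V.letter W.letter (ofLex i)
  isLetter := fun i => by
    obtain ⟨i, rfl⟩ := toLex.surjective i
    rcases i with i | i
    · exact V.isLetter i
    · exact W.isLetter i
  finite_fiber := fun n => by
    refine (((V.finite_fiber n).image (fun i => toLex (Sum.inl i))).union
      ((W.finite_fiber n).image (fun i => toLex (Sum.inr i)))).subset ?_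
    intro i hi
    obtain ⟨i, rfl⟩ := toLex.surjective i
    rcases i with i | i
    · exact Or.inl ⟨i, hi, rfl⟩
    · exact Or.inr ⟨i, hi, rfl⟩

/-- The concatenation `W₀ W₁ ⋯ W_k` of a finite list of words. -/
def concatList (L : List (Word G)) : Word G := L.foldr concat (empty G)

/-- The inverse word: reversed domain, inverted letters. -/
def inv (W : Word G) : Word G where
  Idx := W.Idxᵒᵈ
  letter := fun i => (W.letter (OrderDual.ofDual i))⁻¹
  isLetter := fun i => by
    obtain ⟨n, hn⟩ := W.isLetter (OrderDual.ofDual i)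
    exact ⟨n, inv_mem hn⟩
  finite_fiber := fun n => by
    refine ((W.finite_fiber n).image OrderDual.toDual).subset ?_
    intro i hi
    exact ⟨OrderDual.ofDual i, by simpa using hi, rfl⟩

/-- `W ^ δ` for a sign `δ ∈ {1, -1}`. -/
def signed (W : Word G) (δ : ℤˣ) : Word G := if δ = 1 then W else W.inv

/-- The restriction `W ↾ S` to a set of positions. -/
def restrict (W : Word G) (S : Set W.Idx) : Word G where
  Idx := S
  letter := fun i => W.letter i
  isLetter := fun i => W.isLetter i
  finite_fiber := fun n => Set.Finite.preimage (f := Subtype.val)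
    Subtype.val_injective.injOn (W.finite_fiber n)

/-- Subwords, i.e. the factors `V` in `W ≡ W₀ V W₂`: the restrictions of `W` to intervals. -/
def IsSubword (V W : Word G) : Prop :=
  ∃ I : Set W.Idx, I.OrdConnected ∧ V.Equiv (W.restrict I)

lemma finite_trunc (W : Word G) (N : ℕ) : {i | ∃ n ≤ N, W.letter i ∈ grp G n}.Finite := by
  refine ((Set.finite_Iic N).biUnion (fun n _ => W.finite_fiber n)).subset ?_
  rintro i ⟨n, hn, hi⟩
  exact Set.mem_biUnion (x := n) hn hi

/-- The positions of the finite word `p_N(W)`. -/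
def trunc (W : Word G) (N : ℕ) : Finset W.Idx := (W.finite_trunc N).toFinset

/-- The element of the free product of `G 0, …, G N` (a subgroup of `Monoid.CoprodI G`) spelled
by the finite word `p_N(W)`. -/
def proj (W : Word G) (N : ℕ) : Monoid.CoprodI G :=
  (((W.trunc N).sort (· ≤ ·)).map W.letter).prod

/-- The relation `V ∼ W`. -/
def Sim (V W : Word G) : Prop := ∀ N, V.proj N = W.proj N

/-- Reduced words: no nonempty subword is `∼ E`, and neighbouring letters lie in no common
`G n`. -/
def IsReduced (W : Word G) : Prop :=
  (∀ I : Set W.Idx, I.OrdConnected → (W.restrict I).Sim (empty G) → I = ∅) ∧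
  ∀ i j : W.Idx, i ⋖ j → ¬ ∃ n, W.letter i ∈ grp G n ∧ W.letter j ∈ grp G n

lemma mem_trunc {W : Word G} {N : ℕ} {i : W.Idx} :
    i ∈ W.trunc N ↔ ∃ n ≤ N, W.letter i ∈ grp G n := by
  simp [trunc]

lemma proj_eq {W : Word G} {N : ℕ} {α : Type} [LinearOrder α] (e : α ≃o W.Idx)
    (f : α → Monoid.CoprodI G) (hf : ∀ i, W.letter (e i) = f i) {l : List α} (hl : l.SortedLT)
    (h : ∀ i, i ∈ l ↔ ∃ n ≤ N, f i ∈ grp G n) : W.proj N = (l.map f).prod := by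
  have hm : (l.map e).SortedLT := by
    refine List.Pairwise.sortedLT ?_
    rw [List.pairwise_map]
    exact hl.pairwise.imp (fun h => e.lt_iff_lt.2 h)
  have : (W.trunc N).sort (· ≤ ·) = l.map e := by
    refine (Finset.sortedLT_sort _).eq_of_mem_iff hm (fun i => ?_)
    obtain ⟨i, rfl⟩ := e.surjective i
    rw [Finset.mem_sort, mem_trunc, hf, List.mem_map_of_injective e.injective, h]
  rw [proj, this, List.map_map]
  congr 2
  funext i
  exact hf i

lemma proj_empty (N : ℕ) : (empty G).proj N = 1 := by
  rw [proj_eq (W := empty G) (α := Empty) (OrderIso.refl _) Empty.elim (fun i => i.elim)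
    (l := []) (List.Pairwise.nil.sortedLT) (fun i => i.elim)]
  rfl

lemma proj_concat (V W : Word G) (N : ℕ) : (V.concat W).proj N = V.proj N * W.proj N := by
  rw [proj_eq (W := V.concat W) (α := V.Idx ⊕ₗ W.Idx) (OrderIso.refl _)
    (fun i => Sum.elim V.letter W.letter (ofLex i)) (fun _ => rfl)
    (l := ((V.trunc N).sort (· ≤ ·)).map (fun i => toLex (Sum.inl i)) ++
      ((W.trunc N).sort (· ≤ ·)).map (fun i => toLex (Sum.inr i)))]
  · simp only [List.map_append, List.map_map, List.prod_append]
    rfl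
  · refine List.Pairwise.sortedLT ?_
    rw [List.pairwise_append, List.pairwise_map, List.pairwise_map]
    refine ⟨(Finset.sortedLT_sort _).pairwise.imp (fun h => Sum.Lex.inl_lt_inl_iff.2 h),
      (Finset.sortedLT_sort _).pairwise.imp (fun h => Sum.Lex.inr_lt_inr_iff.2 h), ?_⟩
    intro a ha b hb
    obtain ⟨i, -, rfl⟩ := List.mem_map.1 ha
    obtain ⟨j, -, rfl⟩ := List.mem_map.1 hb
    exact Sum.Lex.inl_lt_inr _ _
  · intro i
    obtain ⟨i, rfl⟩ := toLex.surjective i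
    rcases i with i | i <;> simp [mem_trunc]

lemma proj_inv (W : Word G) (N : ℕ) : W.inv.proj N = (W.proj N)⁻¹ := by
  rw [proj_eq (W := W.inv) (α := W.Idxᵒᵈ) (OrderIso.refl _)
    (fun i => (W.letter (OrderDual.ofDual i))⁻¹) (fun _ => rfl)
    (l := (((W.trunc N).sort (· ≤ ·)).map OrderDual.toDual).reverse)]
  · rw [proj, List.prod_inv_reverse, List.map_reverse, List.map_map, List.map_map]
    rfl
  · refine List.Pairwise.sortedLT ?_
    rw [List.pairwise_reverse, List.pairwise_map]
    exact (Finset.sortedLT_sort _).pairwise.imp (fun h => OrderDual.toDual_lt_toDual.2 h)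
  · intro i
    obtain ⟨i, rfl⟩ := OrderDual.toDual.surjective i
    simp [mem_trunc]

instance simSetoid (G : ℕ → Type u) [∀ n, Group (G n)] : Setoid (Word G) where
  r := Sim
  iseqv := ⟨fun _ _ => rfl, fun h N => (h N).symm, fun h k N => (h N).trans (k N)⟩

end Word

/-! ## The topologist's product and its quotient by the finite words -/

/-- The topologist's product: words modulo `∼`. Every class contains exactly one reduced word up to
`≡`, so this is the group of reduced words with `W₀ ⊚ W₁ = Red(W₀ W₁)`. -/
def TopProd (G : ℕ → Type u) [∀ n, Group (G n)] := Quotient (Word.simSetoid G)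

section TopProd

variable {G : ℕ → Type u} [∀ n, Group (G n)]

/-- The class of a word in the topologist's product. -/
def Word.cls (W : Word G) : TopProd G := Quotient.mk _ W

instance : Mul (TopProd G) where
  mul := Quotient.map₂ Word.concat (fun V V' h W W' k N => by
    rw [Word.proj_concat, Word.proj_concat, h N, k N])

instance : Inv (TopProd G) where
  inv := Quotient.map Word.inv (fun V W h N => by rw [Word.proj_inv, Word.proj_inv, h N])

instance : One (TopProd G) where
  one := (Word.empty G).cls

instance : Group (TopProd G) :=
  Group.ofLeftAxioms
    (by
      rintro ⟨a⟩ ⟨b⟩ ⟨c⟩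
      exact Quotient.sound (fun N => by simp only [Word.proj_concat, mul_assoc]))
    (by
      rintro ⟨a⟩
      exact Quotient.sound (fun N => by simp only [Word.proj_concat, Word.proj_empty, one_mul]))
    (by
      rintro ⟨a⟩
      exact Quotient.sound (fun N => by
        simp only [Word.proj_concat, Word.proj_empty, Word.proj_inv, inv_mul_cancel]))

/-- The free product of the `G n` inside the topologist's product: the classes containing a finite
word. -/
def freeProd (G : ℕ → Type u) [∀ n, Group (G n)] : Subgroup (TopProd G) where
  carrier := {a | ∃ W : Word G, Finite W.Idx ∧ W.cls = a}
  mul_mem' := by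
    rintro _ _ ⟨V, hV, rfl⟩ ⟨W, hW, rfl⟩
    exact ⟨V.concat W, inferInstanceAs (Finite (V.Idx ⊕ W.Idx)), rfl⟩
  one_mem' := ⟨Word.empty G, inferInstanceAs (Finite Empty), rfl⟩
  inv_mem' := by
    rintro _ ⟨W, hW, rfl⟩
    exact ⟨W.inv, hW, rfl⟩

/-- The group `𝒜(G)`: the topologist's product modulo the normal closure of the free product. -/
abbrev Arch (G : ℕ → Type u) [∀ n, Group (G n)] :=
  TopProd G ⧸ Subgroup.normalClosure (freeProd G : Set (TopProd G))

/-- The quotient homomorphism `ℶ`. -/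
def beth (G : ℕ → Type u) [∀ n, Group (G n)] : TopProd G →* Arch G :=
  QuotientGroup.mk' _

/-- The class `[[W]]` of a word in `𝒜(G)`. -/
def Word.dcls (W : Word G) : Arch G := beth G W.cls

/-- `Fine({W_x})`: the subgroup generated by all subwords of the words `W_x`. -/
def Fine {X : Type w} (W : X → Word G) : Subgroup (TopProd G) :=
  Subgroup.closure {a | ∃ x, ∃ V : Word G, V.IsSubword (W x) ∧ V.cls = a}

/-- The letters occurring in the words `W_x` and `W_x⁻¹`. -/
def signedLetters {X : Type w} (W : X → Word G) : Set (Monoid.CoprodI G) :=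
  {g | ∃ x, ∃ i, g = (W x).letter i ∨ g = ((W x).letter i)⁻¹}

/-- The words allowed as factors in a decomposition of an element of `Fine({W_x})`: nonempty
subwords of some `W_x` or `W_x⁻¹`, and words with a single letter `g ∈ G n \ {1}` that is a product
of elements of `G n` occurring as letters of the `W_x`, `W_x⁻¹`. -/
def IsFinePiece {X : Type w} (W : X → Word G) (V : Word G) : Prop :=
  (Nonempty V.Idx ∧ ∃ x, ∃ δ : ℤˣ, V.IsSubword ((W x).signed δ)) ∨
  ∃ i : V.Idx, (∀ j, j = i) ∧ V.letter i ≠ 1 ∧ ∃ n, V.letter i ∈ grp G n ∧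
    V.letter i ∈ Submonoid.closure (signedLetters W ∩ grp G n)

end TopProd

/-! ## Close order isomorphisms -/

/-- `S` is close in `Λ`: it meets every infinite interval of `Λ`. -/
def IsClose {Λ : Type*} [LinearOrder Λ] (S : Set Λ) : Prop :=
  ∀ I : Set Λ, I.OrdConnected → I.Infinite → (I ∩ S).Nonempty

/-- A close order isomorphism (coi) from `Λ` to `Θ`. -/
structure Coi (Λ : Type*) (Θ : Type*) [LinearOrder Λ] [LinearOrder Θ] where
  dom : Set Λ
  ran : Set Θ
  close_dom : IsClose dom
  close_ran : IsClose ran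
  iso : dom ≃o ran

namespace Coi

variable {Λ : Type*} {Θ : Type*} [LinearOrder Λ] [LinearOrder Θ]

/-- The inverse of a coi. -/
def symm (ι : Coi Λ Θ) : Coi Θ Λ where
  dom := ι.ran
  ran := ι.dom
  close_dom := ι.close_ran
  close_ran := ι.close_dom
  iso := ι.iso.symm

/-- `∝(I, ι)`: the smallest interval of `Θ` containing `ι (I ∩ dom ι)`. -/
def hull (ι : Coi Λ Θ) (I : Set Λ) : Set Θ :=
  {θ | ∃ a b : ι.dom, (a : Λ) ∈ I ∧ (b : Λ) ∈ I ∧ (ι.iso a : Θ) ≤ θ ∧ θ ≤ (ι.iso b : Θ)}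

end Coi

/-- A coi triple `coi(W, ι, U)` of reduced words and a coi between their domains. -/
structure CoiTriple (G : ℕ → Type u) (K : ℕ → Type v) [∀ n, Group (G n)] [∀ n, Group (K n)] where
  W : Word G
  U : Word K
  reduced_W : W.IsReduced
  reduced_U : U.IsReduced
  ι : Coi W.Idx U.Idx

section Triples

variable {G : ℕ → Type u} {K : ℕ → Type v} [∀ n, Group (G n)] [∀ n, Group (K n)] {X : Type w}

/-- The triple `coi(U, ι⁻¹, W)`. -/
def CoiTriple.symm (t : CoiTriple G K) : CoiTriple K G where
  W := t.U
  U := t.W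
  reduced_W := t.reduced_U
  reduced_U := t.reduced_W
  ι := t.ι.symm

/-- The first of the two symmetric halves of coherence. -/
def HalfCoherent (T : X → CoiTriple G K) : Prop :=
  ∀ (x y : X) (I : Set (T x).W.Idx) (J : Set (T y).W.Idx) (δ : ℤˣ),
    I.OrdConnected → J.OrdConnected →
    ((T x).W.restrict I).Equiv (((T y).W.restrict J).signed δ) →
    ((T x).U.restrict ((T x).ι.hull I)).dcls =
      (((T y).U.restrict ((T y).ι.hull J)).signed δ).dcls

/-- Coherence of a collection of coi triples. -/
def Coherent (T : X → CoiTriple G K) : Prop :=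
  HalfCoherent T ∧ HalfCoherent (fun x => (T x).symm)

/-- The admissible contributions of a factor `V` to the value of the map induced by the collection:
factors of length at most `1` are omitted (contribute `1`), and a longer factor
`V ≡ (W_x ↾ I) ^ δ` contributes `[[(U_x ↾ ∝(I, ι_x)) ^ δ]]`. -/
def PieceValue (T : X → CoiTriple G K) (V : Word G) (a : Arch K) : Prop :=
  (Subsingleton V.Idx ∧ a = 1) ∨
  (Nontrivial V.Idx ∧ ∃ (x : X) (I : Set (T x).W.Idx) (δ : ℤˣ), I.OrdConnected ∧
    V.Equiv (((T x).W.restrict I).signed δ) ∧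
    a = (((T x).U.restrict ((T x).ι.hull I)).signed δ).dcls)

/-- `a` is obtained from the element `g` by the recipe defining the map induced by the collection:
the reduced word `W` representing `g` is decomposed as `W ≡ W₀ W₁ ⋯ W_k`, with factors as in
`IsFinePiece`, and `a` is the product of contributions of the factors, for some choice of the
decomposition and of the contributions. -/
def InducedValue (T : X → CoiTriple G K) (g : TopProd G) (a : Arch K) : Prop :=
  ∃ W : Word G, W.IsReduced ∧ W.cls = g ∧
    ∃ L : List (Word G), (∀ V ∈ L, IsFinePiece (fun x => (T x).W) V) ∧
      W.Equiv (Word.concatList L) ∧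
      ∃ A : List (Arch K), List.Forall₂ (PieceValue T) L A ∧ A.prod = a

/-- `Fine({W_x})` for the collection `T`. -/
abbrev fineW (T : X → CoiTriple G K) : Subgroup (TopProd G) := Fine (fun x => (T x).W)

/-- `Fine({U_x})` for the collection `T`. -/
abbrev fineU (T : X → CoiTriple G K) : Subgroup (TopProd K) := Fine (fun x => (T x).U)

end Triples

end InfiniteWords

end

/-! A word is the limit of its finite words: up to `≡` it is the compatible family of the letter
lists of `p_N`. Hence words up to `≡` form a cancellative monoid with inversion, `WordType`, in
which two factorisations of one word have a common refinement and subwords are factors.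

Say that a word has value `a` (`HasValue`) if it is a concatenation, reduced or not, of subwords of
the `W_x` and `W_x⁻¹` and of admissible single letters whose contributions multiply to `a`. Cutting
an interval in two cuts its hull in two, up to a gap that misses the range of the coi and so is
finite by closeness. Finite words die in `𝒜`, so contributions multiply under cutting. Coherence
says that a contribution depends only on the factor up to `≡`, and comparing refinements shows that
a word has at most one value (`HasValue.unique`).

The value descends to the topologist's product. A product of two reduced words is reduced by
cancelling a longest `c` against `c⁻¹` and perhaps merging one pair of letters
(`IsReduced.exists_cancel`). The cancelled parts have inverse values and letters contribute `1`, so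
the value survives reduction. Reduced representatives are unique (`IsReduced.eq_of_cls_eq`), because
for large `M` the normal form of `p_M` still displays every letter of index at most `N`. So the
value depends only on the class, which yields `φ₀`, and symmetrically `φ₁`.

An element of the kernel of `ℶ` becomes trivial when the letters of index at most some `N` are
deleted (`exists_cls_delete_eq_one`). Only finitely many letters disappear, so the value is
unchanged (`HasValue.delete`) and `φ₀` kills the kernel. Finally, the hull under `ι⁻¹` of the hull
of `I` exhausts `I` up to finite ends, so `φ₁` takes a suitable representative of `φ₀ W` back to `ℶ
W` (`HasValue.exists_symm`); this makes the descended maps mutually inverse. -/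

noncomputable section

namespace InfiniteWords

open Monoid

/-! ## The finite letter lists of a word -/

section Lists

variable {G : ℕ → Type u} [∀ n, Group (G n)]

/-- The elements of `G 0, …, G N`. -/
def IsSmall (N : ℕ) (x : CoprodI G) : Prop := ∃ n ≤ N, x ∈ grp G n

lemma IsSmall.mono {N M : ℕ} (h : N ≤ M) {x : CoprodI G} (hx : IsSmall N x) : IsSmall M x := by
  obtain ⟨n, hn, hx⟩ := hx
  exact ⟨n, hn.trans h, hx⟩

lemma isSmall_inv {N : ℕ} {x : CoprodI G} : IsSmall N x⁻¹ ↔ IsSmall N x := by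
  simp [IsSmall]

lemma of_mem_grp (n : ℕ) (g : G n) : (CoprodI.of g : CoprodI G) ∈ grp G n := ⟨g, rfl⟩

lemma of_mem_grp_iff {n m : ℕ} {g : G n} (hg : g ≠ 1) :
    (CoprodI.of g : CoprodI G) ∈ grp G m ↔ m = n := by
  refine ⟨?_, fun h => h ▸ of_mem_grp n g⟩
  rintro ⟨k, hk⟩
  by_contra hne
  -- The projection onto `G n` kills every other factor and fixes `g`.
  have := congrArg (CoprodI.lift (fun i => if h : i = n then
    (MonoidHom.id (G n)).comp (h ▸ MonoidHom.id (G i)) else 1)) hk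
  rw [CoprodI.lift_of, CoprodI.lift_of, dif_neg hne, dif_pos rfl] at this
  exact hg this.symm

lemma isSmall_of_iff {n N : ℕ} {g : G n} (hg : g ≠ 1) :
    IsSmall N (CoprodI.of g : CoprodI G) ↔ n ≤ N := by
  constructor
  · rintro ⟨m, hm, h⟩
    rwa [← (of_mem_grp_iff hg).1 h]
  · exact fun h => ⟨n, h, of_mem_grp n g⟩

namespace Word

/-- The letters of the finite word `p_N(W)`, in order. -/
def letters (W : Word G) (N : ℕ) : List (CoprodI G) :=
  ((W.trunc N).sort (· ≤ ·)).map W.letter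

lemma prod_letters (W : Word G) (N : ℕ) : (W.letters N).prod = W.proj N := rfl

lemma mem_trunc_iff {W : Word G} {N : ℕ} {i : W.Idx} :
    i ∈ W.trunc N ↔ IsSmall N (W.letter i) := mem_trunc

lemma exists_mem_trunc (W : Word G) (i : W.Idx) : ∃ N, i ∈ W.trunc N := by
  obtain ⟨n, hn⟩ := W.isLetter i
  exact ⟨n, mem_trunc.2 ⟨n, le_rfl, hn⟩⟩

/-- The positions may be listed in any order `α` into which the domain embeds. A proper embedding is
needed for restrictions, an isomorphism for concatenations and inverses. -/
lemma letters_eq {W : Word G} {N : ℕ} {α : Type} [LinearOrder α] (e : W.Idx ↪o α)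
    (f : α → CoprodI G) (hf : ∀ i, f (e i) = W.letter i) {l : List α} (hl : l.SortedLT)
    (h : ∀ a, a ∈ l ↔ ∃ i, e i = a ∧ IsSmall N (f a)) : W.letters N = l.map f := by
  have hm : (((W.trunc N).sort (· ≤ ·)).map e).SortedLT := by
    refine List.Pairwise.sortedLT ?_
    rw [List.pairwise_map]
    exact (Finset.sortedLT_sort _).pairwise.imp (fun h => e.lt_iff_lt.2 h)
  have : ((W.trunc N).sort (· ≤ ·)).map e = l := by
    refine hm.eq_of_mem_iff hl (fun a => ?_)
    rw [h, List.mem_map]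
    simp only [Finset.mem_sort, mem_trunc_iff]
    constructor
    · rintro ⟨i, hi, rfl⟩
      exact ⟨i, rfl, by rwa [hf]⟩
    · rintro ⟨i, rfl, hi⟩
      exact ⟨i, by rwa [hf] at hi, rfl⟩
  rw [← this, List.map_map, letters]
  exact List.map_congr_left (fun i _ => (hf i).symm)

lemma letters_eq_of_equiv {V W : Word G} (h : V.Equiv W) (N : ℕ) : V.letters N = W.letters N := by
  obtain ⟨e, he⟩ := h
  refine letters_eq e.toOrderEmbedding W.letter he (Finset.sortedLT_sort _) (fun a => ?_)
  rw [Finset.mem_sort, mem_trunc_iff]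
  exact ⟨fun h => ⟨e.symm a, e.apply_symm_apply a, h⟩, fun ⟨_, _, h⟩ => h⟩

lemma letters_restrict {W : Word G} {S : Set W.Idx} {N : ℕ} {l : List W.Idx} (hl : l.SortedLT)
    (h : ∀ i, i ∈ l ↔ i ∈ S ∧ IsSmall N (W.letter i)) :
    (W.restrict S).letters N = l.map W.letter := by
  refine letters_eq (W := W.restrict S) (OrderEmbedding.subtype S) W.letter (fun _ => rfl) hl
    (fun a => ?_)
  rw [h]
  constructor
  · rintro ⟨ha, hs⟩
    exact ⟨⟨a, ha⟩, rfl, hs⟩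
  · rintro ⟨i, rfl, hs⟩
    exact ⟨i.2, hs⟩

lemma sortedLT_filter {α : Type*} [LinearOrder α] {l : List α} (hl : l.SortedLT) (p : α → Bool) :
    (l.filter p).SortedLT :=
  (hl.pairwise.sublist List.filter_sublist).sortedLT

open scoped Classical in
lemma letters_restrict_eq_filter (W : Word G) (S : Set W.Idx) (N : ℕ) :
    (W.restrict S).letters N =
      (((W.trunc N).sort (· ≤ ·)).filter (fun i => decide (i ∈ S))).map W.letter := by
  refine letters_restrict (sortedLT_filter (Finset.sortedLT_sort _) _) (fun i => ?_)
  simp [mem_trunc_iff, and_comm]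

lemma letters_concat (V W : Word G) (N : ℕ) :
    (V.concat W).letters N = V.letters N ++ W.letters N := by
  rw [letters_eq (W := V.concat W) (α := V.Idx ⊕ₗ W.Idx) (OrderIso.refl _).toOrderEmbedding
    (fun i => Sum.elim V.letter W.letter (ofLex i)) (fun _ => rfl)
    (l := ((V.trunc N).sort (· ≤ ·)).map (fun i => toLex (Sum.inl i)) ++
      ((W.trunc N).sort (· ≤ ·)).map (fun i => toLex (Sum.inr i)))]
  · simp only [List.map_append, List.map_map]
    rfl
  · refine List.Pairwise.sortedLT ?_
    rw [List.pairwise_append, List.pairwise_map, List.pairwise_map]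
    refine ⟨(Finset.sortedLT_sort _).pairwise.imp (fun h => Sum.Lex.inl_lt_inl_iff.2 h),
      (Finset.sortedLT_sort _).pairwise.imp (fun h => Sum.Lex.inr_lt_inr_iff.2 h), ?_⟩
    intro a ha b hb
    obtain ⟨i, -, rfl⟩ := List.mem_map.1 ha
    obtain ⟨j, -, rfl⟩ := List.mem_map.1 hb
    exact Sum.Lex.inl_lt_inr _ _
  · intro i
    obtain ⟨i, rfl⟩ := toLex.surjective i
    rcases i with i | i <;> simp [mem_trunc_iff] <;> exact fun _ => ⟨_, rfl⟩

lemma letters_inv (W : Word G) (N : ℕ) :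
    W.inv.letters N = ((W.letters N).map (·⁻¹)).reverse := by
  rw [letters_eq (W := W.inv) (α := W.Idxᵒᵈ) (OrderIso.refl _).toOrderEmbedding
    (fun i => (W.letter (OrderDual.ofDual i))⁻¹) (fun _ => rfl)
    (l := (((W.trunc N).sort (· ≤ ·)).map OrderDual.toDual).reverse)]
  · rw [letters, List.map_reverse, List.map_map, List.map_map]
    rfl
  · refine List.Pairwise.sortedLT ?_
    rw [List.pairwise_reverse, List.pairwise_map]
    exact (Finset.sortedLT_sort _).pairwise.imp (fun h => OrderDual.toDual_lt_toDual.2 h)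
  · intro i
    obtain ⟨i, rfl⟩ := OrderDual.toDual.surjective i
    simp [mem_trunc_iff, isSmall_inv]
    exact fun _ => ⟨_, rfl⟩

lemma letters_empty (N : ℕ) : (empty G).letters N = [] := by
  rw [letters_eq (W := empty G) (α := Empty) (OrderIso.refl _).toOrderEmbedding Empty.elim
    (fun i => i.elim) (l := []) (List.Pairwise.nil.sortedLT) (fun i => i.elim)]
  rfl

open scoped Classical in
lemma letters_filter (W : Word G) {N M : ℕ} (h : N ≤ M) :
    W.letters N = (W.letters M).filter (fun x => decide (IsSmall N x)) := by
  rw [letters, letters, List.filter_map]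
  congr 1
  refine (Finset.sortedLT_sort _).eq_of_mem_iff
    (sortedLT_filter (Finset.sortedLT_sort _) _) (fun i => ?_)
  simp only [Finset.mem_sort, mem_trunc_iff, List.mem_filter, Function.comp, decide_eq_true_iff]
  exact ⟨fun hi => ⟨hi.mono h, hi⟩, And.right⟩

/-- Lists with equal labels lose the same places under a filter that sees only the labels, so the
surviving places remain paired as before. -/
lemma mem_zip_of_mem_zip_filter {α β γ : Type*} (f : α → γ) (g : β → γ) (q : γ → Bool)
    {l : List α} {m : List β} (h : l.map f = m.map g) {p : α × β}
    (hp : p ∈ (l.filter (q ∘ f)).zip (m.filter (q ∘ g))) : p ∈ l.zip m := by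
  induction l generalizing m with
  | nil => simp at hp
  | cons a l ih =>
    cases m with
    | nil => simp at hp
    | cons b m =>
      simp only [List.map_cons, List.cons.injEq] at h
      rw [List.zip_cons_cons, List.mem_cons]
      by_cases hq : q (f a) = true
      · rw [List.filter_cons_of_pos (by simpa using hq),
          List.filter_cons_of_pos (by simpa [← h.1] using hq), List.zip_cons_cons,
          List.mem_cons] at hp
        exact hp.imp_right (ih h.2)
      · rw [List.filter_cons_of_neg (by simpa using hq),
          List.filter_cons_of_neg (by simpa [← h.1] using hq)] at hp
        exact Or.inr (ih h.2 hp)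

lemma eq_of_mem_zip {α β γ : Type*} (f : α → γ) (g : β → γ)
    {l : List α} {m : List β} (h : l.map f = m.map g) {p : α × β}
    (hp : p ∈ l.zip m) : f p.1 = g p.2 := by
  induction l generalizing m with
  | nil => simp at hp
  | cons a l ih =>
    cases m with
    | nil => simp at hp
    | cons b m =>
      simp only [List.map_cons, List.cons.injEq] at h
      rw [List.zip_cons_cons, List.mem_cons] at hp
      rcases hp with rfl | hp
      · exact h.1
      · exact ih h.2 hp

lemma exists_mem_zip {α β : Type*} {l : List α} {m : List β} (h : l.length = m.length) {a : α}
    (ha : a ∈ l) : ∃ b, (a, b) ∈ l.zip m := by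
  rw [← List.map_fst_zip (l₂ := m) h.le, List.mem_map] at ha
  obtain ⟨⟨a, b⟩, hab, rfl⟩ := ha
  exact ⟨b, hab⟩

/-- Two pairs in the zip of increasing lists are equal or ordered the same way in both coordinates.
-/
lemma lt_of_mem_zip {α β : Type*} [LinearOrder α] [LinearOrder β] {l : List α} {m : List β}
    (hl : l.SortedLT) (hm : m.SortedLT) {a a' : α} {b b' : β} (h : (a, b) ∈ l.zip m)
    (h' : (a', b') ∈ l.zip m) : a < a' ↔ b < b' := by
  have key : ∀ {l : List α} {m : List β}, l.Pairwise (· < ·) → m.Pairwise (· < ·) →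
      (l.zip m).Pairwise (fun p q => p.1 < q.1 ∧ p.2 < q.2) := by
    intro l
    induction l with
    | nil => simp
    | cons a l ih =>
      intro m hl hm
      cases m with
      | nil => simp
      | cons b m =>
        rw [List.pairwise_cons] at hl hm
        rw [List.zip_cons_cons, List.pairwise_cons]
        refine ⟨fun p hp => ?_, ih hl.2 hm.2⟩
        have := List.of_mem_zip (a := p.1) (b := p.2) hp
        exact ⟨hl.1 _ this.1, hm.1 _ this.2⟩
  have := key hl.pairwise hm.pairwise
  have tri : (a, b) = (a', b') ∨ (a < a' ∧ b < b') ∨ (a' < a ∧ b' < b) := by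
    by_cases hne : (a, b) = (a', b')
    · exact Or.inl hne
    · refine Or.inr ?_
      have hs : (l.zip m).Pairwise (fun p q => (p.1 < q.1 ∧ p.2 < q.2) ∨ (q.1 < p.1 ∧ q.2 < p.2)) :=
        this.imp Or.inl
      have : Std.Symm (fun p q : α × β => (p.1 < q.1 ∧ p.2 < q.2) ∨ (q.1 < p.1 ∧ q.2 < p.2)) :=
        ⟨fun p q hpq => hpq.symm⟩
      exact hs.forall h h' hne
  rcases tri with h | h | h
  · rw [Prod.mk.injEq] at h
    simp [h.1, h.2]
  · simp [h.1, h.2]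
  · simp [h.1.not_gt, h.2.not_gt]

/-- Pair the `k`-th position of `p_N(V)` with the `k`-th position of `p_N(W)`. Since the labels
agree, the pairings for growing `N` extend each other, and every position appears for some `N`;
their union is the required isomorphism. -/
lemma equiv_of_letters_eq {V W : Word G} (h : ∀ N, V.letters N = W.letters N) : V.Equiv W := by
  classical
  set R : ℕ → V.Idx → W.Idx → Prop := fun N i j =>
    (i, j) ∈ ((V.trunc N).sort (· ≤ ·)).zip ((W.trunc N).sort (· ≤ ·)) with hR
  have mono : ∀ {N M i j}, N ≤ M → R N i j → R M i j := by
    intro N M i j hNM hij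
    have hf : ∀ U : Word G, (U.trunc N).sort (· ≤ ·) =
        ((U.trunc M).sort (· ≤ ·)).filter ((fun x => decide (IsSmall N x)) ∘ U.letter) := by
      intro U
      refine (Finset.sortedLT_sort _).eq_of_mem_iff
        (sortedLT_filter (Finset.sortedLT_sort _) _) (fun i => ?_)
      simp only [Finset.mem_sort, mem_trunc_iff, List.mem_filter, Function.comp,
        decide_eq_true_iff]
      exact ⟨fun hi => ⟨hi.mono hNM, hi⟩, And.right⟩
    change (i, j) ∈ List.zip _ _ at hij
    rw [hf V, hf W] at hij
    exact mem_zip_of_mem_zip_filter _ _ _ (h M) hij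
  have hlen : ∀ N, ((V.trunc N).sort (· ≤ ·)).length = ((W.trunc N).sort (· ≤ ·)).length := by
    intro N
    simpa [letters] using congrArg List.length (h N)
  have left : ∀ i, ∃ j, ∃ N, R N i j := by
    intro i
    obtain ⟨N, hN⟩ := V.exists_mem_trunc i
    obtain ⟨j, hj⟩ := exists_mem_zip (hlen N) ((Finset.mem_sort _).2 hN)
    exact ⟨j, N, hj⟩
  have right : ∀ j, ∃ i, ∃ N, R N i j := by
    intro j
    obtain ⟨N, hN⟩ := W.exists_mem_trunc j
    obtain ⟨i, hi⟩ := exists_mem_zip (hlen N).symm ((Finset.mem_sort _).2 hN)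
    refine ⟨i, N, ?_⟩
    rw [← List.zip_swap, List.mem_map] at hi
    obtain ⟨⟨a, b⟩, hab, he⟩ := hi
    simp only [Prod.swap_prod_mk, Prod.mk.injEq] at he
    obtain ⟨rfl, rfl⟩ := he
    exact hab
  have lt_iff : ∀ {i i' j j'}, (∃ N, R N i j) → (∃ N, R N i' j') → (i < i' ↔ j < j') := by
    rintro i i' j j' ⟨N, hN⟩ ⟨M, hM⟩
    exact lt_of_mem_zip (Finset.sortedLT_sort _) (Finset.sortedLT_sort _)
      (mono (le_max_left N M) hN) (mono (le_max_right N M) hM)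
  choose f hf using left
  have hmono : StrictMono f := fun i i' hii => (lt_iff (hf i) (hf i')).1 hii
  refine ⟨hmono.orderIsoOfSurjective f (fun j => ?_), fun i => ?_⟩
  · obtain ⟨i, hi⟩ := right j
    refine ⟨i, ?_⟩
    -- Here `i` is paired both with `j` and with `f i`; comparing `i` with itself leaves neither of
    -- these smaller than the other.
    have h1 := lt_iff hi (hf i)
    have h2 := lt_iff (hf i) hi
    simp only [lt_irrefl, false_iff, not_lt] at h1 h2
    exact le_antisymm h1 h2
  · obtain ⟨N, hN⟩ := hf i
    exact (eq_of_mem_zip _ _ (h N) hN).symm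

lemma equiv_iff {V W : Word G} : V.Equiv W ↔ ∀ N, V.letters N = W.letters N :=
  ⟨letters_eq_of_equiv, equiv_of_letters_eq⟩

/-- Words up to `≡`. -/
def equivSetoid (G : ℕ → Type u) [∀ n, Group (G n)] : Setoid (Word G) where
  r := Equiv
  iseqv := ⟨fun _ => equiv_iff.2 fun _ => rfl,
    fun h => equiv_iff.2 fun N => (equiv_iff.1 h N).symm,
    fun h k => equiv_iff.2 fun N => (equiv_iff.1 h N).trans (equiv_iff.1 k N)⟩

end Word

end Lists

/-! ## The monoid of words up to `≡` -/

/-- Words up to `≡`. -/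
def WordType (G : ℕ → Type u) [∀ n, Group (G n)] := Quotient (Word.equivSetoid G)

section WordType

variable {G : ℕ → Type u} [∀ n, Group (G n)]

/-- The class of a word up to `≡`. -/
def Word.type (W : Word G) : WordType G := Quotient.mk (Word.equivSetoid G) W

lemma Word.type_eq_iff {V W : Word G} : V.type = W.type ↔ V.Equiv W :=
  Quotient.eq (r := Word.equivSetoid G)

namespace WordType

lemma exists_word (m : WordType G) : ∃ W : Word G, W.type = m := Quotient.exists_rep m

/-- The letters of the finite word `p_N(m)`, in order. -/
def letters (N : ℕ) (m : WordType G) : List (CoprodI G) :=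
  Quotient.lift (s := Word.equivSetoid G) (fun W => W.letters N)
    (fun _ _ h => Word.letters_eq_of_equiv h N) m

@[simp] lemma letters_type (N : ℕ) (W : Word G) : letters N W.type = W.letters N := rfl

@[ext] lemma ext {a b : WordType G} (h : ∀ N, letters N a = letters N b) : a = b := by
  obtain ⟨V, rfl⟩ := a.exists_word
  obtain ⟨W, rfl⟩ := b.exists_word
  exact Word.type_eq_iff.2 (Word.equiv_of_letters_eq h)

instance : Mul (WordType G) where
  mul := Quotient.map₂ Word.concat (fun V V' h W W' k => Word.equiv_iff.2 (fun N => by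
    rw [Word.letters_concat, Word.letters_concat, Word.equiv_iff.1 h N, Word.equiv_iff.1 k N]))

instance : Inv (WordType G) where
  inv := Quotient.map Word.inv (fun V W h => Word.equiv_iff.2 (fun N => by
    rw [Word.letters_inv, Word.letters_inv, Word.equiv_iff.1 h N]))

instance : One (WordType G) where
  one := (Word.empty G).type

lemma type_concat (V W : Word G) : (V.concat W).type = V.type * W.type := rfl

lemma type_inv (V : Word G) : V.inv.type = V.type⁻¹ := rfl

lemma type_empty : (Word.empty G).type = 1 := rfl

@[simp] lemma letters_mul (N : ℕ) (a b : WordType G) :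
    letters N (a * b) = letters N a ++ letters N b := by
  obtain ⟨V, rfl⟩ := a.exists_word
  obtain ⟨W, rfl⟩ := b.exists_word
  exact Word.letters_concat V W N

@[simp] lemma letters_inv (N : ℕ) (a : WordType G) :
    letters N a⁻¹ = ((letters N a).map (·⁻¹)).reverse := by
  obtain ⟨V, rfl⟩ := a.exists_word
  exact Word.letters_inv V N

@[simp] lemma letters_one (N : ℕ) : letters N (1 : WordType G) = [] := Word.letters_empty N

/-- The inverse is only formal: `a * b = 1` forces both words to be empty, which is what makes
`inv_eq_of_mul` hold. -/
instance : DivisionMonoid (WordType G) where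
  mul_assoc a b c := by ext1 N; simp
  one_mul a := by ext1 N; simp
  mul_one a := by ext1 N; simp
  inv_inv a := by ext1 N; simp
  mul_inv_rev a b := by ext1 N; simp
  inv_eq_of_mul a b h := by
    have h' : ∀ N, letters N a = [] ∧ letters N b = [] := fun N => by
      simpa using congrArg (letters N) h
    ext1 N
    simp [(h' N).1, (h' N).2]

/-- Order types alone do not cancel (`1 + ω = ω`). Words do, because each `p_N` is a finite list. -/
instance : IsCancelMul (WordType G) where
  mul_left_cancel a b c h := by
    ext1 N
    simpa using congrArg (letters N) h
  mul_right_cancel a b c h := by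
    ext1 N
    simpa using congrArg (letters N) h

lemma eq_one_iff {a : WordType G} : a = 1 ↔ ∀ N, letters N a = [] :=
  ⟨fun h N => by rw [h, letters_one], fun h => by ext1 N; rw [h, letters_one]⟩

lemma mul_eq_one_iff {a b : WordType G} : a * b = 1 ↔ a = 1 ∧ b = 1 := by
  simp only [eq_one_iff, letters_mul, List.append_eq_nil_iff, forall_and]

lemma type_eq_one_iff {W : Word G} : W.type = 1 ↔ IsEmpty W.Idx := by
  rw [← type_empty, Word.type_eq_iff]
  constructor
  · rintro ⟨e, -⟩
    exact ⟨fun i => (e i).elim⟩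
  · intro h
    exact ⟨⟨⟨isEmptyElim, Empty.elim, isEmptyElim, fun i => i.elim⟩, fun {i} => isEmptyElim i⟩,
      isEmptyElim⟩

open scoped Classical in
lemma letters_filter {N M : ℕ} (h : N ≤ M) (a : WordType G) :
    letters N a = (letters M a).filter (fun x => decide (IsSmall N x)) := by
  obtain ⟨V, rfl⟩ := a.exists_word
  exact V.letters_filter h

/-- The image in the topologist's product. -/
def cls : WordType G →* TopProd G where
  toFun m := Quotient.lift (s := Word.equivSetoid G) Word.cls
    (fun V W h => Quotient.sound (fun N => by
      rw [← Word.prod_letters, ← Word.prod_letters, Word.equiv_iff.1 h N])) m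
  map_one' := rfl
  map_mul' a b := by
    obtain ⟨V, rfl⟩ := a.exists_word
    obtain ⟨W, rfl⟩ := b.exists_word
    rfl

lemma cls_type (W : Word G) : cls W.type = W.cls := rfl

lemma cls_surjective : Function.Surjective (cls : WordType G → TopProd G) := by
  rintro ⟨W⟩
  exact ⟨W.type, rfl⟩

lemma cls_inv (a : WordType G) : cls a⁻¹ = (cls a)⁻¹ := by
  obtain ⟨V, rfl⟩ := a.exists_word
  rfl

lemma cls_eq_iff {a b : WordType G} :
    cls a = cls b ↔ ∀ N, (letters N a).prod = (letters N b).prod := by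
  obtain ⟨V, rfl⟩ := a.exists_word
  obtain ⟨W, rfl⟩ := b.exists_word
  exact Quotient.eq (r := Word.simSetoid G)

lemma cls_eq_one_iff {a : WordType G} : cls a = 1 ↔ ∀ N, (letters N a).prod = 1 := by
  rw [← map_one (cls (G := G)), cls_eq_iff]
  simp

end WordType

open WordType

/-! ### Restrictions and factorisations -/

namespace Word

/-- The class of `W ↾ S` up to `≡`. -/
def part (W : Word G) (S : Set W.Idx) : WordType G := (W.restrict S).type

lemma part_union (W : Word G) {A B : Set W.Idx} (h : ∀ a ∈ A, ∀ b ∈ B, a < b) :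
    W.part (A ∪ B) = W.part A * W.part B := by
  classical
  ext1 N
  rw [part, part, part, WordType.letters_mul, letters_type, letters_type, letters_type,
    letters_restrict_eq_filter W A, letters_restrict_eq_filter W B, ← List.map_append]
  refine letters_restrict ?_ (fun i => ?_)
  · refine List.Pairwise.sortedLT ?_
    rw [List.pairwise_append]
    refine ⟨(sortedLT_filter (Finset.sortedLT_sort _) _).pairwise,
      (sortedLT_filter (Finset.sortedLT_sort _) _).pairwise, ?_⟩
    intro a ha b hb
    simp only [List.mem_filter, decide_eq_true_iff] at ha hb
    exact h a ha.2 b hb.2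
  · simp only [List.mem_append, List.mem_filter, Finset.mem_sort, mem_trunc_iff,
      decide_eq_true_iff, Set.mem_union]
    tauto

lemma part_univ (W : Word G) : W.part Set.univ = W.type :=
  type_eq_iff.2 ⟨OrderIso.Set.univ, fun _ => rfl⟩

lemma part_empty (W : Word G) : W.part ∅ = 1 :=
  type_eq_one_iff.2 (inferInstanceAs (IsEmpty (∅ : Set W.Idx)))

lemma part_eq_one_iff {W : Word G} {S : Set W.Idx} : W.part S = 1 ↔ S = ∅ :=
  type_eq_one_iff.trans Set.isEmpty_coe_sort

/-- A factorisation of a restriction comes from a cut of the set of positions. -/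
lemma part_eq_mul {W : Word G} {S : Set W.Idx} {a b : WordType G} (h : W.part S = a * b) :
    ∃ A B : Set W.Idx, S = A ∪ B ∧ (∀ i ∈ A, ∀ j ∈ B, i < j) ∧ W.part A = a ∧ W.part B = b := by
  obtain ⟨U, rfl⟩ := a.exists_word
  obtain ⟨V, rfl⟩ := b.exists_word
  rw [← type_concat] at h
  obtain ⟨e, he⟩ : ∃ e : (U.Idx ⊕ₗ V.Idx) ≃o S, ∀ i, W.letter (e i) =
    Sum.elim U.letter V.letter (ofLex i) := type_eq_iff.1 h.symm
  let f : U.Idx ⊕ₗ V.Idx → W.Idx := fun i => e i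
  have hf : ∀ i j, f i < f j ↔ i < j := fun i j => e.lt_iff_lt
  have hfl : ∀ i, W.letter (f i) = Sum.elim U.letter V.letter (ofLex i) := he
  refine ⟨Set.range (fun i => f (toLex (Sum.inl i))), Set.range (fun i => f (toLex (Sum.inr i))),
    ?_, ?_, ?_, ?_⟩
  · ext i
    constructor
    · intro hi
      obtain ⟨k, hk⟩ := e.surjective ⟨i, hi⟩
      have hk' : f k = i := congrArg Subtype.val hk
      obtain ⟨k, rfl⟩ := toLex.surjective k
      rcases k with k | k
      · exact Or.inl ⟨k, hk'⟩
      · exact Or.inr ⟨k, hk'⟩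
    · rintro (⟨k, rfl⟩ | ⟨k, rfl⟩)
      · exact (e (toLex (Sum.inl k)) : S).2
      · exact (e (toLex (Sum.inr k)) : S).2
  · rintro _ ⟨i, rfl⟩ _ ⟨j, rfl⟩
    exact (hf _ _).2 (Sum.Lex.inl_lt_inr _ _)
  · have hm : StrictMono (fun i => f (toLex (Sum.inl i))) := fun i j hij =>
      (hf _ _).2 (Sum.Lex.inl_lt_inl_iff.2 hij)
    exact (type_eq_iff.2 ⟨hm.orderIso _, fun i => hfl _⟩).symm
  · have hm : StrictMono (fun i => f (toLex (Sum.inr i))) := fun i j hij =>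
      (hf _ _).2 (Sum.Lex.inr_lt_inr_iff.2 hij)
    exact (type_eq_iff.2 ⟨hm.orderIso _, fun i => hfl _⟩).symm

lemma type_eq_mul {W : Word G} {a b : WordType G} (h : W.type = a * b) :
    ∃ A : Set W.Idx, IsLowerSet A ∧ W.part A = a ∧ W.part Aᶜ = b := by
  rw [← part_univ] at h
  obtain ⟨A, B, hAB, hlt, ha, hb⟩ := part_eq_mul h
  have : B = Aᶜ := by
    ext i
    refine ⟨fun hi hi' => lt_irrefl _ (hlt i hi' i hi), fun hi => ?_⟩
    exact ((hAB ▸ Set.mem_univ i : i ∈ A ∪ B)).resolve_left hi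
  subst this
  refine ⟨A, fun i j hji hi => ?_, ha, hb⟩
  by_contra hj
  exact (hlt i hi j hj).not_ge hji

lemma part_mul_part_compl {W : Word G} {A : Set W.Idx} (h : IsLowerSet A) :
    W.part A * W.part Aᶜ = W.type := by
  rw [← part_union W, Set.union_compl_self, part_univ]
  intro a ha b hb
  by_contra hba
  exact hb (h (not_lt.1 hba) ha)

lemma part_sdiff {W : Word G} {A B : Set W.Idx} (h : IsLowerSet A) (hAB : A ⊆ B) :
    W.part B = W.part A * W.part (B \ A) := by
  rw [← part_union W, Set.union_sdiff_cancel hAB]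
  intro a ha b hb
  by_contra hba
  exact hb.2 (h (not_lt.1 hba) ha)

end Word

namespace WordType

/-- Two cuts of one word are lower sets of a linear order, hence nested; the word between them is
`t`. -/
lemma exists_of_mul_eq_mul {a b c d : WordType G} (h : a * b = c * d) :
    (∃ t, c = a * t ∧ b = t * d) ∨ (∃ t, a = c * t ∧ d = t * b) := by
  obtain ⟨W, hW⟩ := (a * b).exists_word
  obtain ⟨A, hA, rfl, hb⟩ := Word.type_eq_mul hW
  obtain ⟨C, hC, rfl, hd⟩ := Word.type_eq_mul (hW.trans h)
  rcases hA.total hC with hAC | hCA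
  · refine Or.inl ⟨W.part (C \ A), Word.part_sdiff hA hAC, ?_⟩
    have := Word.part_sdiff hA hAC
    rw [this, mul_assoc] at h
    exact mul_left_cancel h
  · refine Or.inr ⟨W.part (A \ C), Word.part_sdiff hC hCA, ?_⟩
    have := Word.part_sdiff hC hCA
    rw [this, mul_assoc] at h
    exact (mul_left_cancel h).symm

end WordType

end WordType

/-! ## One-letter words -/

section Single

variable {G : ℕ → Type u} [∀ n, Group (G n)]

lemma isSmall_one (N : ℕ) : IsSmall N (1 : CoprodI G) := ⟨0, N.zero_le, one_mem _⟩

/-- The word with the single letter `g`. -/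
def Word.single {n : ℕ} (g : G n) : Word G where
  Idx := Unit
  letter := fun _ => CoprodI.of g
  isLetter := fun _ => ⟨n, of_mem_grp n g⟩
  finite_fiber := fun _ => Set.toFinite _

namespace WordType

open Word

/-- The word with the single letter `g`. -/
def single {n : ℕ} (g : G n) : WordType G := (Word.single g).type

open scoped Classical in
lemma letters_single (N : ℕ) {n : ℕ} (g : G n) :
    letters N (single g) = if IsSmall N (CoprodI.of g : CoprodI G) then [CoprodI.of g] else [] := by
  have := Word.letters_eq (W := Word.single g) (N := N) (α := Unit)
    (OrderIso.refl Unit).toOrderEmbedding (fun _ => CoprodI.of g) (fun _ => rfl)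
    (l := if IsSmall N (CoprodI.of g : CoprodI G) then [()] else [])
    (by split_ifs <;> exact List.Pairwise.sortedLT (by simp))
    (fun a => by split_ifs with h <;> simp [h]; exact ⟨()⟩)
  rw [single, letters_type, this]
  split_ifs <;> rfl

lemma letters_single_of_le {N n : ℕ} (h : n ≤ N) (g : G n) :
    letters N (single g) = [CoprodI.of g] := by
  rw [letters_single, if_pos ⟨n, h, of_mem_grp n g⟩]

lemma single_inv {n : ℕ} (g : G n) : (single g)⁻¹ = single g⁻¹ := by
  ext1 N
  rw [letters_inv, letters_single, letters_single, map_inv, isSmall_inv]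
  split_ifs <;> simp

lemma single_ne_one {n : ℕ} (g : G n) : single g ≠ 1 := fun h => by
  simpa [letters_single_of_le le_rfl] using congrArg (letters n) h

lemma single_injective {n : ℕ} : Function.Injective (single : G n → WordType G) := fun g h hgh => by
  simpa [letters_single_of_le le_rfl, CoprodI.of_injective n |>.eq_iff] using
    congrArg (letters n) hgh

lemma cls_single_one {n : ℕ} : cls (single (1 : G n)) = 1 := by
  rw [cls_eq_one_iff]
  intro N
  rw [letters_single]
  split_ifs <;> simp

lemma cls_single_mul {n : ℕ} (g h : G n) : cls (single (g * h)) = cls (single g * single h) := by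
  rw [cls_eq_iff]
  intro N
  rw [letters_mul, letters_single, letters_single, letters_single]
  -- The letter `1` lies in every group and so occurs in every `p_N`. Only for nontrivial letters
  -- does occurrence depend on the index alone, hence the separate cases.
  by_cases hg : g = 1
  · subst hg
    rw [one_mul, map_one, if_pos (isSmall_one N)]
    simp
  by_cases hh : h = 1
  · subst hh
    rw [mul_one, map_one, if_pos (isSmall_one N)]
    simp
  by_cases hgh : g * h = 1
  · obtain rfl := eq_inv_of_mul_eq_one_left hgh
    rw [inv_mul_cancel, map_one, map_inv, isSmall_inv]
    split_ifs <;> simp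
  · simp only [isSmall_of_iff hg, isSmall_of_iff hh, isSmall_of_iff hgh]
    split_ifs <;> simp

lemma eq_one_or_eq_one_of_subsingleton {W : Word G} [Subsingleton W.Idx] {a b : WordType G}
    (h : W.type = a * b) : a = 1 ∨ b = 1 := by
  rw [← W.part_univ] at h
  obtain ⟨A, B, -, hlt, rfl, rfl⟩ := part_eq_mul h
  rw [part_eq_one_iff, part_eq_one_iff]
  by_contra! hne
  obtain ⟨⟨i, hi⟩, ⟨j, hj⟩⟩ := hne
  exact (hlt i hi j hj).ne (Subsingleton.elim i j)

lemma eq_one_or_eq_one_of_single {n : ℕ} {g : G n} {a b : WordType G}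
    (h : single g = a * b) : a = 1 ∨ b = 1 :=
  have : Subsingleton (Word.single g).Idx := inferInstanceAs (Subsingleton Unit)
  eq_one_or_eq_one_of_subsingleton h

lemma type_eq_single {W : Word G} {i : W.Idx} (hi : ∀ j, j = i) {n : ℕ} {g : G n}
    (hg : W.letter i = CoprodI.of g) : W.type = single g := by
  have : Subsingleton W.Idx := ⟨fun a b => (hi a).trans (hi b).symm⟩
  have : Unique W.Idx := ⟨⟨i⟩, hi⟩
  refine type_eq_iff.2 ⟨⟨Equiv.ofUnique W.Idx Unit, fun {a b} => ?_⟩, fun j => ?_⟩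
  · simp [Subsingleton.elim a b]
  · rw [hi j, hg]
    rfl

lemma part_singleton {W : Word G} {i : W.Idx} {n : ℕ} {g : G n}
    (hg : W.letter i = CoprodI.of g) : W.part {i} = single g :=
  type_eq_single (W := W.restrict {i}) (i := ⟨i, rfl⟩) (fun j => Subtype.ext j.2) hg

lemma exists_eq_of_part_eq_single {W : Word G} {S : Set W.Idx} {n : ℕ} {g : G n}
    (h : W.part S = single g) : ∃ i, S = {i} ∧ W.letter i = CoprodI.of g := by
  obtain ⟨e, he⟩ : ∃ e : Unit ≃o S, ∀ i, W.letter (e i) = CoprodI.of g := type_eq_iff.1 h.symm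
  refine ⟨e (), Set.eq_singleton_iff_unique_mem.2 ⟨(e ()).2, fun j hj => ?_⟩, he ()⟩
  obtain ⟨k, hk⟩ := e.surjective ⟨j, hj⟩
  rw [show k = () from rfl] at hk
  exact (congrArg Subtype.val hk).symm

end WordType

end Single

/-- The rest of `J` falls into the points before `I` and the points after it. The latter are
described by a negation, so that for empty `I` all of `J` is put there. -/
lemma exists_ordConnected_split {α : Type*} [LinearOrder α] {I J : Set α} (hI : I.OrdConnected)
    (hJ : J.OrdConnected) (h : I ⊆ J) :
    ∃ A C : Set α, A.OrdConnected ∧ C.OrdConnected ∧ Disjoint A I ∧ Disjoint C I ∧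
      J = A ∪ (I ∪ C) ∧ (∀ a ∈ A, ∀ b ∈ I ∪ C, a < b) ∧ ∀ a ∈ I, ∀ b ∈ C, a < b := by
  have hAI : ∀ a, a ∉ I → (∃ i ∈ I, a < i) → ∀ b ∈ I, a < b := by
    rintro a ha ⟨i, hi, hai⟩ b hb
    by_contra hba
    exact ha (hI.out hb hi ⟨not_lt.1 hba, hai.le⟩)
  refine ⟨{x | x ∈ J ∧ x ∉ I ∧ ∃ i ∈ I, x < i}, {x | x ∈ J ∧ x ∉ I ∧ ¬ ∃ i ∈ I, x < i},
    ⟨?_⟩, ⟨?_⟩, ?_, ?_, ?_, ?_, ?_⟩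
  · rintro x ⟨hx, hx', i, hi, hxi⟩ y ⟨hy, hy', hy''⟩ z ⟨hxz, hzy⟩
    exact ⟨hJ.out hx hy ⟨hxz, hzy⟩, fun hz => (hAI y hy' hy'' z hz).not_ge hzy,
      hy''.imp fun i hi => ⟨hi.1, hzy.trans_lt hi.2⟩⟩
  · rintro x ⟨hx, hx', hx''⟩ y ⟨hy, hy', hy''⟩ z ⟨hxz, hzy⟩
    refine ⟨hJ.out hx hy ⟨hxz, hzy⟩, fun hz => ?_, ?_⟩
    · exact hx'' ⟨z, hz, lt_of_le_of_ne hxz (fun h => hx' (h ▸ hz))⟩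
    · rintro ⟨i, hi, hzi⟩
      exact hx'' ⟨i, hi, hxz.trans_lt hzi⟩
  · exact Set.disjoint_left.2 fun x hx => hx.2.1
  · exact Set.disjoint_left.2 fun x hx => hx.2.1
  · ext x
    by_cases hx : x ∈ I
    · simp [hx, h hx]
    · by_cases hx' : ∃ i ∈ I, x < i
      · simp [hx, hx']
      · simp [hx, hx', -not_exists]
  · rintro a ⟨ha, ha', ha''⟩ b (hb | ⟨hb, hb', hb''⟩)
    · exact hAI a ha' ha'' b hb
    · by_contra hba
      obtain ⟨i, hi, hai⟩ := ha''
      exact hb'' ⟨i, hi, (not_lt.1 hba).trans_lt hai⟩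
  · rintro a ha b ⟨hb, hb', hb''⟩
    by_contra hba
    exact hb'' ⟨a, ha, lt_of_le_of_ne (not_lt.1 hba) (fun h => hb' (h ▸ ha))⟩

/-! ## Reduced words up to `≡` -/

section Reduced

variable {G : ℕ → Type u} [∀ n, Group (G n)]

open Word WordType

/-- Reducedness, in terms of factorisations. -/
structure WordType.IsReduced (m : WordType G) : Prop where
  eq_one : ∀ a b c, m = a * b * c → cls b = 1 → b = 1
  not_adjacent : ∀ a c n (g h : G n), m ≠ a * single g * single h * c

lemma Word.exists_type_eq_mul_part {W : Word G} {I : Set W.Idx} (hI : I.OrdConnected) :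
    ∃ a c, W.type = a * W.part I * c := by
  obtain ⟨A, C, -, -, -, -, hU, hA, hC⟩ :=
    exists_ordConnected_split hI Set.ordConnected_univ (Set.subset_univ I)
  refine ⟨W.part A, W.part C, ?_⟩
  rw [← part_univ, hU, part_union W hA, part_union W hC, mul_assoc]

lemma Word.exists_ordConnected_of_type_eq {W : Word G} {a b c : WordType G}
    (h : W.type = a * b * c) : ∃ I : Set W.Idx, I.OrdConnected ∧ W.part I = b := by
  rw [mul_assoc] at h
  obtain ⟨A, hA, -, hbc⟩ := type_eq_mul h
  obtain ⟨B, C, hBC, hlt, hb, -⟩ := part_eq_mul hbc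
  refine ⟨B, ⟨fun x hx y hy z hz => ?_⟩, hb⟩
  have hzA : z ∈ Aᶜ := fun hzA => (hBC ▸ Or.inl hx : x ∈ Aᶜ) (hA hz.1 hzA)
  rw [hBC] at hzA
  exact hzA.resolve_right fun hzC => (hlt y hy z hzC).not_ge hz.2

lemma Word.cls_part_eq_one_iff {W : Word G} {I : Set W.Idx} :
    WordType.cls (W.part I) = 1 ↔ (W.restrict I).Sim (empty G) :=
  Quotient.eq (r := Word.simSetoid G)

/-- Intervals of positions are the middle factors of factorisations into three, and covering pairs
of positions are the two-letter middle factors. -/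
lemma Word.isReduced_iff {W : Word G} : W.IsReduced ↔ W.type.IsReduced := by
  constructor
  · rintro ⟨h1, h2⟩
    refine ⟨fun a b c h hb => ?_, fun a c n g g' h => ?_⟩
    · obtain ⟨I, hI, rfl⟩ := exists_ordConnected_of_type_eq h
      exact part_eq_one_iff.2 (h1 I hI (cls_part_eq_one_iff.1 hb))
    · rw [mul_assoc a] at h
      obtain ⟨I, hI, hgg⟩ := exists_ordConnected_of_type_eq h
      obtain ⟨A, B, rfl, hlt, hA, hB⟩ := part_eq_mul hgg
      obtain ⟨i, rfl, hi⟩ := exists_eq_of_part_eq_single hA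
      obtain ⟨j, rfl, hj⟩ := exists_eq_of_part_eq_single hB
      refine h2 i j ⟨hlt i rfl j rfl, fun k hik hkj => ?_⟩
        ⟨n, hi ▸ of_mem_grp n g, hj ▸ of_mem_grp n g'⟩
      rcases hI.out (Or.inl rfl) (Or.inr rfl) ⟨hik.le, hkj.le⟩ with hk | hk
      · exact hik.ne' hk
      · exact hkj.ne hk
  · rintro ⟨h1, h2⟩
    refine ⟨fun I hI hs => ?_, ?_⟩
    · obtain ⟨a, c, h⟩ := exists_type_eq_mul_part hI
      exact part_eq_one_iff.1 (h1 a _ c h (cls_part_eq_one_iff.2 hs))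
    · rintro i j hij ⟨n, ⟨g, hg⟩, ⟨g', hg'⟩⟩
      have hI : ({i} ∪ {j} : Set W.Idx).OrdConnected := by
        refine ⟨fun x hx y hy z hz => ?_⟩
        have hiz : i ≤ z := le_trans (by rcases hx with rfl | rfl; exacts [le_rfl, hij.le]) hz.1
        have hzj : z ≤ j := hz.2.trans (by rcases hy with rfl | rfl; exacts [hij.le, le_rfl])
        rcases hiz.eq_or_lt with rfl | hiz
        · exact Or.inl rfl
        · exact Or.inr (hzj.eq_of_not_lt (hij.2 hiz))
      obtain ⟨a, c, h⟩ := exists_type_eq_mul_part hI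
      rw [part_union W (by rintro _ rfl _ rfl; exact hij.lt), part_singleton hg.symm,
        part_singleton hg'.symm, ← mul_assoc] at h
      exact h2 a c n g g' h

namespace WordType

lemma IsReduced.factor {a b c : WordType G} (h : (a * b * c).IsReduced) : b.IsReduced where
  eq_one a' b' c' hb := h.eq_one (a * a') b' (c' * c) (by rw [hb]; simp only [mul_assoc])
  not_adjacent a' c' n g g' hb :=
    h.not_adjacent (a * a') (c' * c) n g g' (by rw [hb]; simp only [mul_assoc])

lemma IsReduced.left {a b : WordType G} (h : (a * b).IsReduced) : a.IsReduced :=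
  IsReduced.factor (a := 1) (c := b) (by rwa [one_mul])

lemma IsReduced.right {a b : WordType G} (h : (a * b).IsReduced) : b.IsReduced :=
  IsReduced.factor (a := a) (c := 1) (by rwa [mul_one])

lemma IsReduced.inv {a : WordType G} (h : a.IsReduced) : a⁻¹.IsReduced where
  eq_one x b y ha hb := by
    have := h.eq_one y⁻¹ b⁻¹ x⁻¹ (by rw [← inv_inv a, ha]; simp [mul_assoc])
      (by rw [cls_inv, hb, inv_one])
    rwa [inv_eq_one] at this
  not_adjacent x y n g g' ha :=
    h.not_adjacent y⁻¹ x⁻¹ n g'⁻¹ g⁻¹ (by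
      rw [← inv_inv a, ha]; simp [mul_assoc, single_inv])

lemma IsReduced.eq_one_of_cls {a : WordType G} (h : a.IsReduced) (ha : cls a = 1) : a = 1 :=
  h.eq_one 1 a 1 (by simp) ha

lemma isReduced_one : (1 : WordType G).IsReduced where
  eq_one _ _ _ h _ := (mul_eq_one_iff.1 (mul_eq_one_iff.1 h.symm).1).2
  not_adjacent _ _ _ _ g' h :=
    single_ne_one g' (mul_eq_one_iff.1 (mul_eq_one_iff.1 h.symm).1).2

lemma IsReduced.letter_ne_one {n : ℕ} {g : G n} (h : (single g).IsReduced) : g ≠ 1 := by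
  rintro rfl
  exact single_ne_one _ (h.eq_one_of_cls cls_single_one)

lemma isReduced_single {n : ℕ} {g : G n} (hg : g ≠ 1) : (single g).IsReduced where
  eq_one a b c h hb := by
    rw [mul_assoc] at h
    rcases eq_one_or_eq_one_of_single h with rfl | hbc
    · rw [one_mul] at h
      rcases eq_one_or_eq_one_of_single h with hb' | rfl
      · exact hb'
      · rw [mul_one] at h
        subst h
        rw [cls_eq_one_iff] at hb
        have := hb n
        rw [letters_single_of_le le_rfl, List.prod_singleton, map_eq_one_iff _
          (CoprodI.of_injective n)] at this
        exact absurd this hg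
    · exact (mul_eq_one_iff.1 hbc).1
  not_adjacent a c m g' h' h := by
    rw [mul_assoc] at h
    rcases eq_one_or_eq_one_of_single h with h | h
    · exact single_ne_one _ (mul_eq_one_iff.1 h).2
    · exact single_ne_one _ (mul_eq_one_iff.1 h).1

end WordType

end Reduced

/-! ## Deleting the letters of small index -/

section Delete

variable {G : ℕ → Type u} [∀ n, Group (G n)]

open Word WordType

open scoped Classical in
/-- The endomorphism of the free product that kills the factors with index outside `P`. -/
def retract (P : Set ℕ) : CoprodI G →* CoprodI G :=
  CoprodI.lift (fun n => if n ∈ P then CoprodI.of else 1)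

lemma retract_prod (P : Set ℕ) (q : CoprodI G → Prop) [DecidablePred q] (l : List (CoprodI G))
    (h : ∀ x ∈ l, retract P x = if q x then x else 1) :
    retract P l.prod = (l.filter (fun x => decide (q x))).prod := by
  induction l with
  | nil => simp
  | cons x l ih =>
    rw [List.forall_mem_cons] at h
    rw [List.prod_cons, map_mul, ih h.2, h.1, List.filter_cons]
    by_cases hq : q x <;> simp [hq]

open scoped Classical in
lemma retract_Iic {N : ℕ} {x : CoprodI G} {M : ℕ} (hx : IsSmall M x) :
    retract (Set.Iic N) x = if IsSmall N x then x else 1 := by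
  obtain ⟨n, -, g, rfl⟩ := hx
  by_cases hg : g = 1
  · subst hg
    simp
  · rw [isSmall_of_iff hg, retract, CoprodI.lift_of]
    simp only [Set.mem_Iic]
    split_ifs <;> rfl

open scoped Classical in
lemma retract_Ioi {N : ℕ} {x : CoprodI G} {M : ℕ} (hx : IsSmall M x) :
    retract (Set.Ioi N) x = if ¬ IsSmall N x then x else 1 := by
  obtain ⟨n, -, g, rfl⟩ := hx
  by_cases hg : g = 1
  · subst hg
    simp
  · rw [isSmall_of_iff hg, retract, CoprodI.lift_of]
    simp only [Set.mem_Ioi, not_le]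
    split_ifs <;> rfl

namespace WordType

lemma isSmall_of_mem_letters {N : ℕ} {m : WordType G} {x : CoprodI G} (hx : x ∈ letters N m) :
    IsSmall N x := by
  obtain ⟨W, rfl⟩ := m.exists_word
  obtain ⟨i, hi, rfl⟩ := List.mem_map.1 hx
  exact mem_trunc_iff.1 ((Finset.mem_sort _).1 hi)

/-- Passing from `p_M` to `p_N` is induced by a homomorphism, so once `p_N` is nontrivial every
later `p_M` is. -/
lemma retract_prod_letters {N M : ℕ} (h : N ≤ M) (m : WordType G) :
    retract (Set.Iic N) (letters M m).prod = (letters N m).prod := by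
  classical
  rw [letters_filter h]
  exact retract_prod _ _ _ (fun x hx => retract_Iic (isSmall_of_mem_letters hx))

open scoped Classical in
lemma _root_.InfiniteWords.Word.letters_restrict_not_small (W : Word G) (N M : ℕ) :
    (W.restrict {i | ¬ IsSmall N (W.letter i)}).letters M =
      (W.letters M).filter (fun x => decide (¬ IsSmall N x)) := by
  rw [letters_restrict_eq_filter, Word.letters, List.filter_map]
  congr 2
  ext i
  exact decide_eq_decide.2 Iff.rfl

/-- The word obtained by deleting the letters in `G 0, …, G N`. -/
def delete (N : ℕ) (m : WordType G) : WordType G :=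
  Quotient.map' (s₁ := equivSetoid G) (s₂ := equivSetoid G)
    (fun W => W.restrict {i | ¬ IsSmall N (W.letter i)})
    (fun V W h => equiv_iff.2 (fun M => by
      rw [Word.letters_restrict_not_small, Word.letters_restrict_not_small,
        letters_eq_of_equiv h])) m

open scoped Classical in
lemma letters_delete (N M : ℕ) (m : WordType G) :
    letters M (delete N m) = (letters M m).filter (fun x => decide (¬ IsSmall N x)) := by
  obtain ⟨W, rfl⟩ := m.exists_word
  exact W.letters_restrict_not_small N M

lemma delete_mul (N : ℕ) (a b : WordType G) : delete N (a * b) = delete N a * delete N b := by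
  classical
  ext1 M
  simp [letters_delete]

lemma delete_inv (N : ℕ) (a : WordType G) : delete N a⁻¹ = (delete N a)⁻¹ := by
  classical
  ext1 M
  simp only [letters_delete, letters_inv, List.filter_reverse, List.filter_map]
  congr 3
  ext x
  simp [isSmall_inv]

lemma delete_one (N : ℕ) : delete N (1 : WordType G) = 1 := by
  classical
  ext1 M
  simp [letters_delete]

lemma delete_single {N n : ℕ} (h : n ≤ N) (g : G n) : delete N (single g) = 1 := by
  classical
  ext1 M
  rw [letters_delete, letters_single, letters_one]
  split_ifs
  · rw [List.filter_eq_nil_iff]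
    simpa using IsSmall.mono h ⟨n, le_rfl, of_mem_grp n g⟩
  · rfl

lemma delete_eq_self {N : ℕ} {m : WordType G} (h : letters N m = []) : delete N m = m := by
  classical
  ext1 M
  rw [letters_delete, List.filter_eq_self]
  intro x hx
  rw [decide_eq_true_iff]
  intro hs
  have hx' : x ∈ letters (max N M) m := by
    rw [letters_filter (le_max_right N M), List.mem_filter] at hx
    exact hx.1
  have : x ∈ letters N m := by
    rw [letters_filter (le_max_left N M), List.mem_filter]
    exact ⟨hx', by simpa using hs⟩
  rw [h] at this
  simp at this

lemma delete_delete {N M : ℕ} (h : N ≤ M) (m : WordType G) :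
    delete M (delete N m) = delete M m := by
  classical
  ext1 K
  rw [letters_delete, letters_delete, letters_delete, List.filter_filter]
  congr 1
  ext x
  simp only [← Bool.decide_and, decide_eq_decide, and_iff_left_iff_imp]
  exact fun hx hx' => hx (hx'.mono h)

/-- Deletion is induced by the endomorphism of the free product that kills the factors of index at
most `N`, hence respects `∼`. -/
lemma cls_delete_congr (N : ℕ) {a b : WordType G} (h : cls a = cls b) :
    cls (delete N a) = cls (delete N b) := by
  classical
  rw [cls_eq_iff] at h ⊢
  intro M
  have key : ∀ m : WordType G,
      (letters M (delete N m)).prod = retract (Set.Ioi N) (letters M m).prod := fun m => by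
    rw [letters_delete]
    refine (retract_prod _ (fun x : CoprodI G => ¬ IsSmall N x) _ (fun x hx => ?_)).symm
    exact retract_Ioi (isSmall_of_mem_letters hx)
  rw [key, key, h]

/-- The first letter in `G 0, …, G N` of a word. -/
lemma exists_first_letter {N : ℕ} {m : WordType G} (h : letters N m ≠ []) :
    ∃ (p q : WordType G) (n : ℕ) (g : G n), n ≤ N ∧ m = p * (single g * q) ∧
      letters N p = [] := by
  classical
  obtain ⟨W, rfl⟩ := m.exists_word
  have hne : (W.trunc N).Nonempty := by
    rw [Finset.nonempty_iff_ne_empty]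
    intro h0
    apply h
    rw [letters_type, Word.letters, h0]
    simp
  set i := (W.trunc N).min' hne with hi
  obtain ⟨n, hn, g, hg⟩ := mem_trunc_iff.1 ((W.trunc N).min'_mem hne)
  refine ⟨W.part (Set.Iio i), W.part (Set.Ioi i), n, g, hn, ?_, ?_⟩
  · rw [← part_singleton hg.symm, ← part_union W, ← part_union W, ← part_univ]
    · congr 1
      ext j
      rcases lt_trichotomy j i with hj | hj | hj <;> simp [hj, ← hi]
    · rintro a ha b (rfl | hb)
      · exact ha
      · exact lt_trans ha hb
    · rintro a rfl b hb
      exact hb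
  · rw [part, letters_type, letters_restrict_eq_filter, List.map_eq_nil_iff,
      List.filter_eq_nil_iff]
    intro j hj
    rw [Finset.mem_sort] at hj
    simpa using (W.trunc N).min'_le j hj

end WordType

end Delete

/-! ## Uniqueness of reduced words -/

section Unique

variable {G : ℕ → Type u} [∀ n, Group (G n)]

open Word WordType

/-- Multiplying letters together never introduces a new index, so the normal form stays over `S`. -/
lemma exists_coprodWord (S : Set ℕ) (l : List (CoprodI G)) (h : ∀ x ∈ l, ∃ n ∈ S, x ∈ grp G n) :
    ∃ w : CoprodI.Word G, w.prod = l.prod ∧ ∀ p ∈ w.toList, p.1 ∈ S := by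
  classical
  induction l with
  | nil => exact ⟨CoprodI.Word.empty, rfl, by simp [CoprodI.Word.empty]⟩
  | cons x l ih =>
    rw [List.forall_mem_cons] at h
    obtain ⟨w, hw, hS⟩ := ih h.2
    obtain ⟨n, hn, g, rfl⟩ := h.1
    refine ⟨CoprodI.of g • w, by rw [CoprodI.Word.prod_smul, hw, List.prod_cons], ?_⟩
    rintro ⟨k, a⟩ hp
    rcases CoprodI.Word.mem_smul_iff.1 hp with ⟨-, h⟩ | ⟨-, h, -⟩
    · exact hS _ h
    · exact h ▸ hn

-- Between consecutive letters of index at most `N` there is either nothing, and then the letters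
-- lie in different groups, or a nonempty reduced word, which is nontrivial in `p_M` for all large
-- `M` and whose normal form uses only indices above `N`. In both cases the small letters cannot
-- merge, so the normal form of `p_M` displays exactly `p_N`. The last clause, on the head, is what
-- the induction needs in order to put a further letter in front.
open scoped Classical in
lemma WordType.IsReduced.exists_coprodWord {m : WordType G} (hm : m.IsReduced) (N : ℕ) :
    ∃ M₀, ∀ M ≥ M₀, ∃ w : CoprodI.Word G, w.prod = (letters M m).prod ∧
      (w.toList.filter (fun p => decide (p.1 ≤ N))).map (fun p => (CoprodI.of p.2 : CoprodI G)) =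
        letters N m ∧
      ∀ p ∈ w.toList.head?, p.1 ≤ N → ∃ q, m = single p.2 * q := by
  have large : ∀ u : WordType G, letters N u = [] → ∀ M, ∃ w : CoprodI.Word G,
      w.prod = (letters M u).prod ∧ ∀ p ∈ w.toList, N < p.1 := by
    intro u hu M
    refine InfiniteWords.exists_coprodWord (Set.Ioi N) _ (fun x hx => ?_)
    obtain ⟨n, -, hn⟩ := isSmall_of_mem_letters hx
    refine ⟨n, ?_, hn⟩
    by_contra hnN
    rw [← delete_eq_self hu, letters_delete, List.mem_filter, decide_eq_true_iff] at hx
    exact hx.2 ⟨n, not_lt.1 hnN, hn⟩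
  induction hk : (letters N m).length generalizing m with
  | zero =>
    rw [List.length_eq_zero_iff] at hk
    refine ⟨0, fun M _ => ?_⟩
    obtain ⟨w, hw, hN⟩ := large m hk M
    refine ⟨w, hw, ?_, fun p hp hpN => absurd (hN p (List.mem_of_mem_head? hp)) hpN.not_gt⟩
    rw [hk, List.map_eq_nil_iff, List.filter_eq_nil_iff]
    intro p hp
    simpa using hN p hp
  | succ k ih =>
    obtain ⟨p, q, n, g, hn, rfl, hp⟩ := exists_first_letter (N := N) (m := m)
      (fun h => by simp [h] at hk)
    have hg : g ≠ 1 := hm.right.left.letter_ne_one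
    obtain ⟨M₁, hM₁⟩ := ih hm.right.right (by
      simpa [hp, letters_single_of_le hn] using hk)
    -- Beyond this threshold a nonempty gap `p` is visible in `p_M`.
    have hM₂ : ∃ M₂, p = 1 ∨ ∀ M ≥ M₂, (letters M p).prod ≠ 1 := by
      by_cases hp1 : p = 1
      · exact ⟨0, Or.inl hp1⟩
      · have : ¬ ∀ N, (letters N p).prod = 1 := fun h =>
          hp1 (hm.left.eq_one_of_cls (cls_eq_one_iff.2 h))
        push Not at this
        obtain ⟨M₂, hM₂⟩ := this
        refine ⟨M₂, Or.inr fun M hM h => hM₂ ?_⟩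
        rw [← retract_prod_letters hM, h, map_one]
    obtain ⟨M₂, hM₂⟩ := hM₂
    refine ⟨max N (max M₁ M₂), fun M hM => ?_⟩
    simp only [ge_iff_le, max_le_iff] at hM
    obtain ⟨w, hw, hwN, hhead⟩ := hM₁ M hM.2.1
    -- If the normal form of the tail began in `G n`, then so would the tail itself, and `g` would
    -- have a neighbour in its own group.
    have hne : w.fstIdx ≠ some n := by
      rw [CoprodI.Word.fstIdx_ne_iff]
      rintro ⟨n', g'⟩ hg' rfl
      obtain ⟨q', hq'⟩ := hhead _ hg' hn
      exact hm.not_adjacent p q' n g g' (by rw [hq']; simp only [mul_assoc])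
    set w₁ := CoprodI.Word.cons g w hne hg with hw₁
    have hw₁p : w₁.prod = CoprodI.of g * (letters M q).prod := by
      rw [hw₁, CoprodI.Word.prod_cons, hw]
    rcases hM₂ with rfl | hM₂
    · refine ⟨w₁, ?_, ?_, ?_⟩
      · rw [hw₁p]
        simp [letters_single_of_le (hn.trans hM.1)]
      · rw [hw₁, CoprodI.Word.cons, List.filter_cons_of_pos (by simpa using hn), List.map_cons, hwN]
        simp [letters_single_of_le hn]
      · intro x hx hxN
        simp only [hw₁, CoprodI.Word.cons, List.head?_cons, Option.mem_def,
          Option.some.injEq] at hx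
        subst hx
        exact ⟨q, by simp⟩
    -- A nonempty gap contributes a nonempty normal form over indices above `N`, which can be placed
    -- directly before `g`.
    · obtain ⟨w₀, hw₀, hw₀N⟩ := large p hp M
      have hw₀ne : w₀.toList ≠ [] := fun h => hM₂ M hM.2.2 (by
        rw [← hw₀, CoprodI.Word.prod, h]; rfl)
      refine ⟨⟨w₀.toList ++ w₁.toList, ?_, ?_⟩, ?_, ?_, ?_⟩
      · intro l hl
        rcases List.mem_append.1 hl with hl | hl
        · exact w₀.ne_one l hl
        · exact w₁.ne_one l hl
      · rw [List.isChain_append]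
        refine ⟨w₀.chain_ne, w₁.chain_ne, fun x hx y hy => ?_⟩
        simp only [hw₁, CoprodI.Word.cons, List.head?_cons, Option.mem_def,
          Option.some.injEq] at hy
        subst hy
        exact (hn.trans_lt (hw₀N x (List.mem_of_mem_getLast? hx))).ne'
      · rw [CoprodI.Word.prod, List.map_append, List.prod_append]
        change w₀.prod * w₁.prod = _
        rw [hw₀, hw₁p]
        simp [letters_single_of_le (hn.trans hM.1)]
      · have h0 : w₀.toList.filter (fun p => decide (p.1 ≤ N)) = [] := by
          rw [List.filter_eq_nil_iff]
          intro p hp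
          simpa using hw₀N p hp
        rw [List.filter_append, h0, List.nil_append, hw₁, CoprodI.Word.cons,
          List.filter_cons_of_pos (by simpa using hn), List.map_cons, hwN]
        simp [letters_single_of_le hn, hp]
      · intro x hx hxN
        rw [List.head?_append_of_ne_nil _ hw₀ne] at hx
        exact absurd (hw₀N x (List.mem_of_mem_head? hx)) hxN.not_gt

/-- For `M` large enough for both words, the two normal forms represent one element of the free
product, hence coincide, and `p_N` is read off from them. -/
theorem WordType.IsReduced.eq_of_cls_eq {a b : WordType G} (ha : a.IsReduced) (hb : b.IsReduced)
    (h : cls a = cls b) : a = b := by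
  classical
  ext1 N
  obtain ⟨M₁, h₁⟩ := ha.exists_coprodWord N
  obtain ⟨M₂, h₂⟩ := hb.exists_coprodWord N
  obtain ⟨w, hw, hwN, -⟩ := h₁ (max M₁ M₂) (le_max_left _ _)
  obtain ⟨w', hw', hwN', -⟩ := h₂ (max M₁ M₂) (le_max_right _ _)
  have : w = w' := CoprodI.Word.equiv.symm.injective (by
    change w.prod = w'.prod
    rw [hw, hw', cls_eq_iff.1 h])
  rw [← hwN, ← hwN', this]

end Unique

/-! ## Products of reduced words -/

section Product

variable {G : ℕ → Type u} [∀ n, Group (G n)]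

open Word WordType

lemma Word.letters_part_congr {W : Word G} {S T : Set W.Idx} {N : ℕ}
    (h : ∀ i ∈ W.trunc N, i ∈ S ↔ i ∈ T) :
    WordType.letters N (W.part S) = WordType.letters N (W.part T) := by
  classical
  rw [part, part, letters_type, letters_type, letters_restrict_eq_filter,
    letters_restrict_eq_filter]
  congr 1
  refine List.filter_congr (fun i hi => ?_)
  rw [Finset.mem_sort] at hi
  exact decide_eq_decide.2 (h i hi)

/-- The pairs of initial segments of two words that agree up to `≡`. -/
def Word.commonPrefixes (A B : Word G) : Set (Set A.Idx × Set B.Idx) :=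
  {p | IsLowerSet p.1 ∧ IsLowerSet p.2 ∧ A.part p.1 = B.part p.2}

/-- By cancellation a prefix of `A` matches at most one prefix of `B`, monotonically; so the common
prefixes form a chain. -/
lemma Word.commonPrefixes_subset {A B : Word G} {p q : Set A.Idx × Set B.Idx}
    (hp : p ∈ A.commonPrefixes B) (hq : q ∈ A.commonPrefixes B) (h : p.1 ⊆ q.1) : p.2 ⊆ q.2 := by
  obtain ⟨hp1, hp2, hp⟩ := hp
  obtain ⟨hq1, hq2, hq⟩ := hq
  rcases hp2.total hq2 with h2 | h2
  · exact h2
  have e1 := part_sdiff hp1 h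
  have e2 := part_sdiff hq2 h2
  rw [hp, hq, e2, mul_assoc] at e1
  have := (mul_eq_one_iff.1 (left_eq_mul.1 e1)).1
  exact Set.sdiff_eq_empty.1 (part_eq_one_iff.1 this)

lemma Word.commonPrefixes_total {A B : Word G} {p q : Set A.Idx × Set B.Idx}
    (hp : p ∈ A.commonPrefixes B) (hq : q ∈ A.commonPrefixes B) : p ≤ q ∨ q ≤ p := by
  rcases hp.1.total hq.1 with h | h
  · exact Or.inl ⟨h, commonPrefixes_subset hp hq h⟩
  · exact Or.inr ⟨h, commonPrefixes_subset hq hp h⟩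

/-- In a chain, finitely many positions that are each reached by some common prefix are reached by a
single one. This is the finiteness behind the passage to the union of all common prefixes. -/
lemma Word.exists_commonPrefix_of_finset {A B : Word G} (F : Finset A.Idx) (F' : Finset B.Idx) :
    ∃ p ∈ A.commonPrefixes B, (∀ i ∈ F, (∃ q ∈ A.commonPrefixes B, i ∈ q.1) → i ∈ p.1) ∧
      ∀ i ∈ F', (∃ q ∈ A.commonPrefixes B, i ∈ q.2) → i ∈ p.2 := by
  classical
  have step : ∀ (s t : Set (Set A.Idx × Set B.Idx)),
      (∀ p ∈ A.commonPrefixes B, ∀ q ∈ A.commonPrefixes B, p ≤ q → p ∈ s → q ∈ s) →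
      (∀ p ∈ A.commonPrefixes B, ∀ q ∈ A.commonPrefixes B, p ≤ q → p ∈ t → q ∈ t) →
      (∃ p ∈ A.commonPrefixes B, p ∈ s) → (∃ p ∈ A.commonPrefixes B, p ∈ t) →
      ∃ p ∈ A.commonPrefixes B, p ∈ s ∧ p ∈ t := by
    rintro s t hs ht ⟨p, hp, hps⟩ ⟨q, hq, hqt⟩
    rcases commonPrefixes_total hp hq with h | h
    · exact ⟨q, hq, hs p hp q hq h hps, hqt⟩
    · exact ⟨p, hp, hps, ht q hq p hp h hqt⟩
  have hne : ∃ p, p ∈ A.commonPrefixes B :=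
    ⟨(∅, ∅), isLowerSet_empty, isLowerSet_empty, by rw [part_empty, part_empty]⟩
  have one : ∀ s : Set (Set A.Idx × Set B.Idx), ∃ p ∈ A.commonPrefixes B,
      (∃ q ∈ A.commonPrefixes B, q ∈ s) → p ∈ s := fun s => by
    by_cases h : ∃ q ∈ A.commonPrefixes B, q ∈ s
    · obtain ⟨q, hq, hqs⟩ := h
      exact ⟨q, hq, fun _ => hqs⟩
    · obtain ⟨p, hp⟩ := hne
      exact ⟨p, hp, fun h' => absurd h' h⟩
  refine step {p | ∀ i ∈ F, (∃ q ∈ A.commonPrefixes B, i ∈ q.1) → i ∈ p.1}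
    {p | ∀ i ∈ F', (∃ q ∈ A.commonPrefixes B, i ∈ q.2) → i ∈ p.2}
    (fun p _ q _ hpq hp i hi h => hpq.1 (hp i hi h))
    (fun p _ q _ hpq hp i hi h => hpq.2 (hp i hi h)) ?_ ?_
  · induction F using Finset.induction_on with
    | empty => simpa using hne
    | insert i F _ ih =>
      obtain ⟨p, hp, hp1, hp2⟩ := step {p | (∃ q ∈ A.commonPrefixes B, i ∈ q.1) → i ∈ p.1}
        {p | ∀ i ∈ F, (∃ q ∈ A.commonPrefixes B, i ∈ q.1) → i ∈ p.1}
        (fun p _ q _ hpq hp h => hpq.1 (hp h)) (fun p _ q _ hpq hp i hi h => hpq.1 (hp i hi h))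
        (one {p | i ∈ p.1}) ih
      exact ⟨p, hp, Finset.forall_mem_insert _ _ _ |>.2 ⟨hp1, hp2⟩⟩
  · induction F' using Finset.induction_on with
    | empty => simpa using hne
    | insert i F _ ih =>
      obtain ⟨p, hp, hp1, hp2⟩ := step {p | (∃ q ∈ A.commonPrefixes B, i ∈ q.2) → i ∈ p.2}
        {p | ∀ i ∈ F, (∃ q ∈ A.commonPrefixes B, i ∈ q.2) → i ∈ p.2}
        (fun p _ q _ hpq hp h => hpq.2 (hp h)) (fun p _ q _ hpq hp i hi h => hpq.2 (hp i hi h))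
        (one {p | i ∈ p.2}) ih
      exact ⟨p, hp, Finset.forall_mem_insert _ _ _ |>.2 ⟨hp1, hp2⟩⟩

namespace WordType

/-- Two words have a longest common initial segment. -/
lemma exists_maximal_common_prefix (a b : WordType G) :
    ∃ p a' b', a = p * a' ∧ b = p * b' ∧
      ∀ d a'' b'', a' = d * a'' → b' = d * b'' → d = 1 := by
  obtain ⟨A, rfl⟩ := a.exists_word
  obtain ⟨B, rfl⟩ := b.exists_word
  set S : Set A.Idx := {i | ∃ q ∈ A.commonPrefixes B, i ∈ q.1} with hS
  set T : Set B.Idx := {i | ∃ q ∈ A.commonPrefixes B, i ∈ q.2} with hT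
  have hSl : IsLowerSet S := fun i j hji ⟨q, hq, hi⟩ => ⟨q, hq, hq.1 hji hi⟩
  have hTl : IsLowerSet T := fun i j hji ⟨q, hq, hi⟩ => ⟨q, hq, hq.2.1 hji hi⟩
  -- The unions still match, because `p_N` sees only finitely many positions and on these a single
  -- common prefix agrees with the union.
  have hST : A.part S = B.part T := by
    ext1 N
    obtain ⟨p, hp, hpS, hpT⟩ := exists_commonPrefix_of_finset (A.trunc N) (B.trunc N)
    rw [letters_part_congr (S := S) (T := p.1) fun i hi => ⟨hpS i hi, fun h => ⟨p, hp, h⟩⟩,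
      letters_part_congr (S := T) (T := p.2) fun i hi => ⟨hpT i hi, fun h => ⟨p, hp, h⟩⟩, hp.2.2]
  refine ⟨A.part S, A.part Sᶜ, B.part Tᶜ, (part_mul_part_compl hSl).symm, ?_, ?_⟩
  · rw [hST, part_mul_part_compl hTl]
  intro d a'' b'' ha hb
  have hA : A.type = A.part S * d * a'' := by rw [mul_assoc, ← ha, part_mul_part_compl hSl]
  have hB : B.type = A.part S * d * b'' := by rw [mul_assoc, ← hb, hST, part_mul_part_compl hTl]
  obtain ⟨S', hS', hpS', -⟩ := type_eq_mul hA
  obtain ⟨T', hT', hpT', -⟩ := type_eq_mul hB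
  -- A prolongation by `d` would be a common prefix, hence already contained in the union `S`.
  have hsub : S' ⊆ S := fun i hi => ⟨(S', T'), ⟨hS', hT', hpS'.trans hpT'.symm⟩, hi⟩
  have := part_sdiff hS' hsub
  rw [hpS', mul_assoc] at this
  exact (mul_eq_one_iff.1 (left_eq_mul.1 this)).1

/-- A cut of a word lies to the left or to the right of a given letter. -/
lemma exists_of_mul_single_mul_eq {x y c d : WordType G} {n : ℕ} {g : G n}
    (h : x * single g * y = c * d) :
    (∃ s, c = x * single g * s ∧ y = s * d) ∨ ∃ s, x = c * s ∧ d = s * single g * y := by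
  rcases exists_of_mul_eq_mul h with ⟨t, rfl, ht⟩ | ⟨t, ht, rfl⟩
  · exact Or.inl ⟨t, rfl, ht⟩
  · rcases exists_of_mul_eq_mul ht with ⟨s, rfl, hs⟩ | ⟨s, rfl, rfl⟩
    · rcases eq_one_or_eq_one_of_single hs with rfl | rfl
      · exact Or.inr ⟨1, by simp, by rw [hs]; simp⟩
      · exact Or.inl ⟨1, by rw [hs]; simp, by simp⟩
    · exact Or.inr ⟨s, rfl, rfl⟩

lemma mul_single_inj {x y : WordType G} {n m : ℕ} {g : G n} {h : G m}
    (e : x * single g = y * single h) : x = y ∧ single g = single h := by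
  rcases exists_of_mul_single_mul_eq (y := 1) ((mul_one _).trans e) with ⟨s, -, hs⟩ | ⟨s, rfl, hs⟩
  · exact absurd (mul_eq_one_iff.1 hs.symm).2 (single_ne_one h)
  · rw [mul_one] at hs
    rcases eq_one_or_eq_one_of_single hs with rfl | h'
    · exact ⟨mul_one _, by rw [hs, one_mul]⟩
    · exact absurd h' (single_ne_one g)

lemma single_mul_inj {x y : WordType G} {n m : ℕ} {g : G n} {h : G m}
    (e : single g * x = single h * y) : x = y ∧ single g = single h := by
  have := mul_single_inj (x := x⁻¹) (y := y⁻¹) (g := g⁻¹) (h := h⁻¹) (by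
    rw [← single_inv, ← single_inv, ← mul_inv_rev, ← mul_inv_rev, e])
  rwa [← single_inv, ← single_inv, inv_inj, inv_inj] at this

lemma index_eq_of_single_eq {n m : ℕ} {g : G n} {h : G m} (hg : g ≠ 1)
    (e : single g = single h) : m = n := by
  refine (of_mem_grp_iff hg).1 ?_
  have := congrArg (letters (max n m)) e
  rw [letters_single_of_le (le_max_left _ _), letters_single_of_le (le_max_right _ _),
    List.singleton_inj] at this
  rw [this]
  exact of_mem_grp m h

/-- A trivial factor across the seam is `s * t` with `s` ending `A` and `t` beginning `B`. Both are
reduced, so uniqueness gives `s = t⁻¹`, and by `hmax` nothing is left to cancel. -/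
lemma isReduced_mul {A B : WordType G} (hA : A.IsReduced) (hB : B.IsReduced)
    (hmax : ∀ d x y, A = x * d → B = d⁻¹ * y → d = 1)
    (hadj : ∀ x y n (g h : G n), A = x * single g → B ≠ single h * y) : (A * B).IsReduced where
  eq_one x f y e hf := by
    rcases exists_of_mul_eq_mul e with ⟨t, e1, rfl⟩ | ⟨t, rfl, -⟩
    · rcases exists_of_mul_eq_mul e1 with ⟨s, rfl, rfl⟩ | ⟨s, rfl, rfl⟩
      · rw [map_mul, mul_eq_one_iff_eq_inv, ← cls_inv] at hf
        have hst := hA.right.eq_of_cls_eq hB.left.inv hf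
        have hs : s = 1 := hmax s x y rfl (by rw [hst, inv_inv])
        have ht : t = 1 := by rw [← inv_inv t, ← hst, hs, inv_one]
        rw [hs, ht, one_mul]
      · exact hB.eq_one s f y rfl hf
    · exact hA.eq_one x f t rfl hf
  not_adjacent x y n g h e := by
    rw [mul_assoc (x * _)] at e
    rcases exists_of_mul_single_mul_eq e.symm with ⟨s, rfl, e1⟩ | ⟨s, -, rfl⟩
    · rcases exists_of_mul_single_mul_eq (x := 1) ((congrArg (· * y) (one_mul _)).trans e1) with
        ⟨t, rfl, -⟩ | ⟨t, ht, rfl⟩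
      · exact hA.not_adjacent x t n g h (by simp only [mul_assoc, one_mul])
      · obtain ⟨rfl, rfl⟩ := mul_eq_one_iff.1 ht.symm
        exact hadj x y n g h (mul_one _) (by rw [one_mul])
    · exact hB.not_adjacent s y n g h (by simp only [mul_assoc])

/-- If `g * h = 1`, the letter `g` could still be cancelled. A trivial factor `r (gh) s` through the
merged letter gives `r g = (h s)⁻¹` by uniqueness of reduced words, again a cancellation. The merged
letter keeps its index, so bad neighbours would already be present beside `g` or `h`. -/
lemma isReduced_mul_single_mul {a b : WordType G} {n : ℕ} {g h : G n}
    (hA : (a * single g).IsReduced) (hB : (single h * b).IsReduced)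
    (hmax : ∀ d x y, a * single g = x * d → single h * b = d⁻¹ * y → d = 1) :
    (a * single (g * h) * b).IsReduced := by
  have hgh : g * h ≠ 1 := fun hgh => single_ne_one g <| hmax _ a b rfl (by
    rw [single_inv, eq_inv_of_mul_eq_one_right hgh])
  refine ⟨fun x f y e hf => ?_, fun x y m g' h' e => ?_⟩
  · rcases exists_of_mul_single_mul_eq e with ⟨s, e1, rfl⟩ | ⟨s, rfl, -⟩
    · rcases exists_of_mul_single_mul_eq e1.symm with ⟨t, -, rfl⟩ | ⟨r, rfl, rfl⟩
      · exact hB.right.eq_one t f y rfl hf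
      · have e2 : cls (r * single g) = cls (single h * s)⁻¹ := by
          rw [cls_inv, ← mul_eq_one_iff_eq_inv, ← hf]
          simp only [map_mul, cls_single_mul, mul_assoc]
        have e3 := (IsReduced.right (a := x) (by rwa [← mul_assoc])).eq_of_cls_eq
          (IsReduced.left (b := y) (by rwa [mul_assoc])).inv e2
        have := hmax (r * single g) x y (mul_assoc _ _ _)
          (by rw [e3, inv_inv, mul_assoc])
        exact absurd (mul_eq_one_iff.1 this).2 (single_ne_one g)
    · exact hA.left.eq_one x f s rfl hf
  · rw [mul_assoc (x * _)] at e
    rcases exists_of_mul_single_mul_eq e with ⟨s, e1, rfl⟩ | ⟨s, rfl, e1⟩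
    · rcases exists_of_mul_single_mul_eq (y := 1) ((mul_one _).trans e1) with
        ⟨t, e2, ht⟩ | ⟨t, -, rfl⟩
      · obtain ⟨rfl, rfl⟩ := mul_eq_one_iff.1 ht.symm
        rw [mul_one] at e2
        obtain rfl := index_eq_of_single_eq hgh (mul_single_inj e2).2
        exact hB.not_adjacent 1 y _ h h' (by simp only [mul_assoc, one_mul])
      · exact hB.right.not_adjacent t y m g' h' (by simp only [mul_assoc, mul_one])
    · rw [mul_assoc s] at e1
      rcases exists_of_mul_single_mul_eq (x := 1) ((congrArg (· * y) (one_mul _)).trans e1) with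
        ⟨t, rfl, -⟩ | ⟨t, ht, e2⟩
      · exact hA.left.not_adjacent x t m g' h' (by simp only [mul_assoc, one_mul])
      · obtain ⟨rfl, rfl⟩ := mul_eq_one_iff.1 ht.symm
        rw [one_mul] at e2
        obtain rfl := index_eq_of_single_eq hgh (single_mul_inj e2).2
        exact hA.not_adjacent x 1 _ g' g (by simp only [mul_one])

/-- The reduced form of a product of two reduced words: cancel a final segment of the first against
an initial segment of the second, and then multiply the neighbouring letters if they lie in the
same group. -/
theorem IsReduced.exists_cancel {a b : WordType G} (ha : a.IsReduced) (hb : b.IsReduced) :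
    ∃ a' b' c, a = a' * c ∧ b = c⁻¹ * b' ∧ ((a' * b').IsReduced ∨
      ∃ a'' b'' n, ∃ g h : G n, a' = a'' * single g ∧ b' = single h * b'' ∧
        (a'' * single (g * h) * b'').IsReduced) := by
  obtain ⟨p, x, b', hx, rfl, hmax⟩ := exists_maximal_common_prefix a⁻¹ b
  obtain rfl : a = x⁻¹ * p⁻¹ := by rw [← inv_inv a, hx, mul_inv_rev]
  have hmax' : ∀ d u y, x⁻¹ = u * d → b' = d⁻¹ * y → d = 1 := fun d u y h1 h2 => by
    have := hmax d⁻¹ u⁻¹ y (by rw [← mul_inv_rev, ← h1, inv_inv]) h2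
    rwa [inv_eq_one] at this
  refine ⟨x⁻¹, b', p⁻¹, rfl, by rw [inv_inv], ?_⟩
  by_cases hadj : ∃ u y n, ∃ g h : G n, x⁻¹ = u * single g ∧ b' = single h * y
  · obtain ⟨u, y, n, g, h, hu, rfl⟩ := hadj
    rw [hu] at ha hmax' ⊢
    exact Or.inr ⟨u, y, n, g, h, rfl, rfl, isReduced_mul_single_mul ha.left hb.right hmax'⟩
  · exact Or.inl (isReduced_mul ha.left hb.right hmax' fun u y n g h h1 h2 =>
      hadj ⟨u, y, n, g, h, h1, h2⟩)

end WordType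

end Product

/-! ## Hulls under close order isomorphisms -/

namespace Coi

variable {Λ : Type*} {Θ : Type*} [LinearOrder Λ] [LinearOrder Θ] (ι : Coi Λ Θ)

lemma hull_ordConnected (I : Set Λ) : (ι.hull I).OrdConnected := by
  refine ⟨?_⟩
  rintro x ⟨a, b, ha, hb, hax, hxb⟩ y ⟨c, d, hc, hd, hcy, hyd⟩ z ⟨hxz, hzy⟩
  exact ⟨a, d, ha, hd, hax.trans hxz, hzy.trans hyd⟩

lemma hull_mono {I J : Set Λ} (h : I ⊆ J) : ι.hull I ⊆ ι.hull J :=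
  fun _ ⟨a, b, ha, hb, h'⟩ => ⟨a, b, h ha, h hb, h'⟩

lemma hull_lt_hull {A B : Set Λ} (h : ∀ a ∈ A, ∀ b ∈ B, a < b) :
    ∀ a ∈ ι.hull A, ∀ b ∈ ι.hull B, a < b := by
  rintro x ⟨-, b, -, hb, -, hxb⟩ y ⟨c, -, hc, -, hcy, -⟩
  exact hxb.trans_lt (lt_of_lt_of_le (ι.iso.lt_iff_lt.2 (h b hb c hc)) hcy)

/-- This is why factors of length one can be omitted: they correspond to at most one letter, which
is trivial in `𝒜`. -/
lemma hull_subsingleton {I : Set Λ} (hI : I.Subsingleton) : (ι.hull I).Subsingleton := by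
  have key : ∀ a b : ι.dom, (a : Λ) ∈ I → (b : Λ) ∈ I → a = b := fun a b ha hb =>
    Subtype.ext (hI ha hb)
  rintro x ⟨a, b, ha, hb, hax, hxb⟩ y ⟨c, d, hc, hd, hcy, hyd⟩
  obtain rfl := key a b ha hb
  obtain rfl := key a c ha hc
  obtain rfl := key a d ha hd
  exact (hxb.antisymm hax).trans (hyd.antisymm hcy).symm

lemma mem_of_iso_mem_hull {I : Set Λ} (hI : I.OrdConnected) {c : ι.dom}
    (hc : (ι.iso c : Θ) ∈ ι.hull I) : (c : Λ) ∈ I := by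
  obtain ⟨a, b, ha, hb, hac, hcb⟩ := hc
  exact hI.out ha hb ⟨ι.iso.le_iff_le.1 hac, ι.iso.le_iff_le.1 hcb⟩

lemma iso_mem_hull {I : Set Λ} {c : ι.dom} (hc : (c : Λ) ∈ I) : (ι.iso c : Θ) ∈ ι.hull I :=
  ⟨c, c, hc, hc, le_rfl, le_rfl⟩

lemma _root_.InfiniteWords.IsClose.finite {S I : Set Λ} (hS : IsClose S) (hI : I.OrdConnected)
    (h : Disjoint I S) : I.Finite := by
  by_contra hinf
  obtain ⟨x, hx⟩ := hS I hI hinf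
  exact Set.disjoint_left.1 h hx.1 hx.2

/-- The hull of an interval cut into two is, up to a finite interval, the union of the hulls. -/
lemma exists_hull_union {A B : Set Λ} (hAB : (A ∪ B).OrdConnected)
    (hlt : ∀ a ∈ A, ∀ b ∈ B, a < b) :
    ∃ M : Set Θ, M.Finite ∧ ι.hull (A ∪ B) = ι.hull A ∪ (M ∪ ι.hull B) ∧
      (∀ a ∈ ι.hull A, ∀ b ∈ M ∪ ι.hull B, a < b) ∧ ∀ a ∈ M, ∀ b ∈ ι.hull B, a < b := by
  set M : Set Θ := ι.hull (A ∪ B) \ (ι.hull A ∪ ι.hull B) with hM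
  have hAM : ∀ a ∈ ι.hull A, ∀ b ∈ M, a < b := by
    rintro x ⟨-, b, -, hb, -, hxb⟩ y ⟨⟨c, d, hc, hd, hcy, hyd⟩, hy⟩
    by_contra hyx
    rw [not_lt] at hyx
    refine hy ?_
    rcases hc with hc | hc
    · exact Or.inl ⟨c, b, hc, hb, hcy, hyx.trans hxb⟩
    · exact absurd (ι.iso.le_iff_le.1 ((hcy.trans hyx).trans hxb) : c ≤ b)
        (not_le.2 (hlt b hb c hc))
  have hMB : ∀ a ∈ M, ∀ b ∈ ι.hull B, a < b := by
    rintro y ⟨⟨c, d, hc, hd, hcy, hyd⟩, hy⟩ x ⟨a, -, ha, -, hax, -⟩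
    by_contra hyx
    rw [not_lt] at hyx
    refine hy ?_
    rcases hd with hd | hd
    · exact absurd (ι.iso.le_iff_le.1 ((hax.trans hyx).trans hyd) : a ≤ d)
        (not_le.2 (hlt d hd a ha))
    · exact Or.inr ⟨a, d, ha, hd, hax.trans hyx, hyd⟩
  -- The gap `M` is an interval, and a point of it in the range of `ι` would come from `A` or from
  -- `B` and so lie in one of their hulls.
  refine ⟨M, ι.close_ran.finite ⟨fun x hx y hy z hz => ⟨?_, ?_⟩⟩ ?_, ?_, ?_, hMB⟩
  · exact (ι.hull_ordConnected _).out hx.1 hy.1 hz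
  · rintro (h | h)
    · exact (hAM z h x hx).not_ge hz.1
    · exact (hMB y hy z h).not_ge hz.2
  · refine Set.disjoint_left.2 fun x hx hxr => ?_
    obtain ⟨c, hc⟩ := ι.iso.surjective ⟨x, hxr⟩
    obtain rfl : (ι.iso c : Θ) = x := congrArg Subtype.val hc
    rcases ι.mem_of_iso_mem_hull hAB hx.1 with h | h
    · exact hx.2 (Or.inl (ι.iso_mem_hull h))
    · exact hx.2 (Or.inr (ι.iso_mem_hull h))
  · ext x
    have h1 : x ∈ ι.hull A → x ∈ ι.hull (A ∪ B) := fun h => ι.hull_mono Set.subset_union_left h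
    have h2 : x ∈ ι.hull B → x ∈ ι.hull (A ∪ B) := fun h => ι.hull_mono Set.subset_union_right h
    simp only [hM, Set.mem_union, Set.mem_sdiff]
    tauto
  · rintro a ha b (hb | hb)
    · exact hAM a ha b hb
    · exact ι.hull_lt_hull hlt a ha b hb

lemma hull_symm_hull_subset {I : Set Λ} (hI : I.OrdConnected) :
    ι.symm.hull (ι.hull I) ⊆ I := by
  rintro x ⟨a, b, ha, hb, hax, hxb⟩
  have key : ∀ a : ι.ran, (a : Θ) ∈ ι.hull I → ((ι.iso.symm a : ι.dom) : Λ) ∈ I := fun a ha =>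
    ι.mem_of_iso_mem_hull hI (by rwa [OrderIso.apply_symm_apply])
  exact hI.out (key a ha) (key b hb) ⟨hax, hxb⟩

/-- Thus the part of `I` outside the double hull contains no point of `ι.dom`; for an interval `I`
it consists of two end intervals, finite by closeness. -/
lemma mem_hull_symm_hull {I : Set Λ} {c : Λ} (hc : c ∈ I) (hd : c ∈ ι.dom) :
    c ∈ ι.symm.hull (ι.hull I) := by
  have := ι.symm.iso_mem_hull (I := ι.hull I) (c := ι.iso ⟨c, hd⟩) (ι.iso_mem_hull hc)
  have h : ι.symm.iso (ι.iso ⟨c, hd⟩) = ⟨c, hd⟩ := ι.iso.symm_apply_apply _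
  rwa [h] at this

end Coi

/-! ### Finite words and the kernel of `ℶ` -/

section Beth

variable {G : ℕ → Type u} [∀ n, Group (G n)]

open Word hiding cls single letters
open WordType

lemma beth_cls_eq_one_of_finite {W : Word G} (h : Finite W.Idx) : beth G (cls W.type) = 1 :=
  (QuotientGroup.eq_one_iff _).2 (Subgroup.subset_normalClosure ⟨W, h, rfl⟩)

lemma Word.beth_cls_part_of_finite {W : Word G} {S : Set W.Idx} (h : S.Finite) :
    beth G (WordType.cls (W.part S)) = 1 :=
  beth_cls_eq_one_of_finite (W := W.restrict S) h

lemma WordType.beth_cls_single {n : ℕ} (g : G n) : beth G (cls (single g)) = 1 :=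
  beth_cls_eq_one_of_finite (W := Word.single g) (inferInstanceAs (Finite Unit))

/-- The elements of the topologist's product that become trivial when the letters of `G 0, …, G N`
are deleted, for some `N`. -/
def deleteKer (G : ℕ → Type u) [∀ n, Group (G n)] : Subgroup (TopProd G) where
  carrier := {g | ∃ N, ∀ m, cls m = g → cls (delete N m) = 1}
  one_mem' := ⟨0, fun m hm => by
    rw [cls_delete_congr 0 (hm.trans (map_one cls).symm), delete_one, map_one]⟩
  mul_mem' := by
    -- Further deletion keeps a trivial element trivial, so the larger of two thresholds serves both
    -- factors.
    have mono : ∀ {N M : ℕ}, N ≤ M → ∀ {m : WordType G}, cls (delete N m) = 1 →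
        cls (delete M m) = 1 := by
      intro N M h m hm
      rw [← delete_delete h, cls_delete_congr M (hm.trans (map_one cls).symm), delete_one, map_one]
    rintro a b ⟨N, hN⟩ ⟨M, hM⟩
    obtain ⟨a, rfl⟩ := cls_surjective a
    obtain ⟨b, rfl⟩ := cls_surjective b
    refine ⟨max N M, fun m hm => ?_⟩
    rw [← map_mul] at hm
    rw [cls_delete_congr _ hm, delete_mul, map_mul, mono (le_max_left N M) (hN a rfl),
      mono (le_max_right N M) (hM b rfl), one_mul]
  inv_mem' := by
    rintro a ⟨N, hN⟩
    obtain ⟨a, rfl⟩ := cls_surjective a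
    refine ⟨N, fun m hm => ?_⟩
    rw [← cls_inv] at hm
    rw [cls_delete_congr _ hm, delete_inv, cls_inv, hN a rfl, inv_one]

instance : (deleteKer G).Normal where
  conj_mem := by
    rintro a ⟨N, hN⟩ b
    obtain ⟨a, rfl⟩ := cls_surjective a
    obtain ⟨b, rfl⟩ := cls_surjective b
    refine ⟨N, fun m hm => ?_⟩
    rw [← cls_inv, ← map_mul, ← map_mul] at hm
    rw [cls_delete_congr _ hm, delete_mul, delete_mul, map_mul, map_mul, hN a rfl, delete_inv,
      cls_inv, mul_one, mul_inv_cancel]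

/-- A finite word involves boundedly many indices, so one deletion empties it. -/
lemma freeProd_le_deleteKer : freeProd G ≤ deleteKer G := by
  rintro _ ⟨W, hW, rfl⟩
  choose N hN using W.exists_mem_trunc
  obtain ⟨M, hM⟩ := (Set.finite_range N).bddAbove
  refine ⟨M, fun m hm => ?_⟩
  have : delete M W.type = 1 := by
    refine type_eq_one_iff (W := W.restrict _) |>.2 ⟨fun i => i.2 ?_⟩
    exact (mem_trunc_iff.1 (hN i.1)).mono (hM ⟨i.1, rfl⟩)
  rw [cls_delete_congr M (hm.trans (cls_type W).symm), this, map_one]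

/-- A word representing a trivial element of `𝒜` becomes trivial in the topologist's product on
deleting finitely many letters. -/
lemma WordType.exists_cls_delete_eq_one {m : WordType G} (h : beth G (cls m) = 1) :
    ∃ N, cls (delete N m) = 1 := by
  have hm : cls m ∈ Subgroup.normalClosure (freeProd G : Set (TopProd G)) :=
    (QuotientGroup.eq_one_iff _).1 h
  -- `deleteKer` is normal and contains the finite words, hence contains their normal closure.
  obtain ⟨N, hN⟩ := Subgroup.normalClosure_le_normal freeProd_le_deleteKer hm
  exact ⟨N, hN m rfl⟩

end Beth

/-! ## The values of words -/

section Values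

variable {G : ℕ → Type u} {K : ℕ → Type v} [∀ n, Group (G n)] [∀ n, Group (K n)] {X : Type w}

open Word hiding cls single letters
open WordType

/-- The products of elements of `G n` occurring as letters of the words `W_x`, `W_x⁻¹`. -/
def fineLetters (W : X → Word G) (n : ℕ) : Set (G n) :=
  {g | (CoprodI.of g : CoprodI G) ∈ Submonoid.closure (signedLetters W ∩ grp G n)}

lemma mul_mem_fineLetters {W : X → Word G} {n : ℕ} {g h : G n} (hg : g ∈ fineLetters W n)
    (hh : h ∈ fineLetters W n) : g * h ∈ fineLetters W n := by
  rw [fineLetters, Set.mem_ofPred_eq, map_mul]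
  exact mul_mem hg hh

lemma inv_mem_fineLetters {W : X → Word G} {n : ℕ} {g : G n} (hg : g ∈ fineLetters W n) :
    g⁻¹ ∈ fineLetters W n := by
  rw [fineLetters, Set.mem_ofPred_eq] at hg ⊢
  rw [map_inv]
  generalize (CoprodI.of g : CoprodI G) = y at hg ⊢
  induction hg using Submonoid.closure_induction with
  | mem x hx =>
    refine Submonoid.subset_closure ⟨?_, inv_mem hx.2⟩
    obtain ⟨y, i, h | h⟩ := hx.1
    · exact ⟨y, i, Or.inr (by rw [h])⟩
    · exact ⟨y, i, Or.inl (by rw [h, inv_inv])⟩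
  | one => simp
  | mul x y _ _ hx hy =>
    rw [mul_inv_rev]
    exact mul_mem hy hx

lemma mem_fineLetters_of_letter {W : X → Word G} {x : X} {i : (W x).Idx} {n : ℕ} {g : G n}
    (h : (W x).letter i = CoprodI.of g) : g ∈ fineLetters W n :=
  Submonoid.subset_closure ⟨⟨x, i, Or.inl h.symm⟩, of_mem_grp n g⟩

lemma Word.cls_part_mem_fine {W : X → Word G} {x : X} {I : Set (W x).Idx} (hI : I.OrdConnected) :
    WordType.cls ((W x).part I) ∈ Fine W :=
  Subgroup.subset_closure ⟨x, (W x).restrict I, ⟨I, hI, type_eq_iff.1 rfl⟩, rfl⟩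

lemma cls_single_mem_fine {W : X → Word G} {n : ℕ} {g : G n} (hg : g ∈ fineLetters W n) :
    cls (single g) ∈ Fine W := by
  have : ∃ h : G n, (CoprodI.of h : CoprodI G) = CoprodI.of g ∧ cls (single h) ∈ Fine W := by
    rw [fineLetters, Set.mem_ofPred_eq] at hg
    generalize (CoprodI.of g : CoprodI G) = y at hg ⊢
    induction hg using Submonoid.closure_induction with
    | mem x hx =>
      obtain ⟨⟨y, i, h⟩, k, rfl⟩ := hx
      refine ⟨k, rfl, ?_⟩
      rcases h with h | h
      · rw [← part_singleton h.symm]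
        exact cls_part_mem_fine Set.ordConnected_singleton
      · have h : (W y).letter i = CoprodI.of k⁻¹ := by rw [map_inv, h, inv_inv]
        rw [← inv_inv k, ← single_inv, cls_inv, ← part_singleton h]
        exact inv_mem (cls_part_mem_fine Set.ordConnected_singleton)
    | one => exact ⟨1, map_one _, by rw [cls_single_one]; exact one_mem _⟩
    | mul x y _ _ hx hy =>
      obtain ⟨a, rfl, ha⟩ := hx
      obtain ⟨b, rfl, hb⟩ := hy
      exact ⟨a * b, map_mul _ _ _, by rw [cls_single_mul, map_mul]; exact mul_mem ha hb⟩
  obtain ⟨h, hh, hm⟩ := this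
  rwa [CoprodI.of_injective n hh] at hm

variable (T : X → CoiTriple G K)

/-- `a` is the class of the subword of `U_x` corresponding to a subword `m` of `W_x`. -/
def PartValue (m : WordType G) (a : Arch K) : Prop :=
  ∃ (x : X) (I : Set (T x).W.Idx), I.OrdConnected ∧ m = (T x).W.part I ∧
    a = beth K (cls ((T x).U.part ((T x).ι.hull I)))

/-- The contribution of a factor, the factor being allowed to be empty. -/
def FactorValue (m : WordType G) (a : Arch K) : Prop :=
  (m = 1 ∧ a = 1) ∨ (∃ n, ∃ g ∈ fineLetters (fun x => (T x).W) n, m = single g ∧ a = 1) ∨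
    PartValue T m a ∨ PartValue T m⁻¹ a⁻¹

/-- The products of contributions over the factors of a decomposition. -/
inductive HasValue : WordType G → Arch K → Prop
  | one : HasValue 1 1
  | cons {m r : WordType G} {a b : Arch K} (h : FactorValue T m a) (hr : HasValue r b) :
      HasValue (m * r) (a * b)

variable {T}

/-- The gap between the two hulls is a finite word, which `ℶ` kills. -/
lemma Coi.beth_cls_hull_union (t : CoiTriple G K) {A B : Set t.W.Idx} (h : (A ∪ B).OrdConnected)
    (hlt : ∀ a ∈ A, ∀ b ∈ B, a < b) :
    beth K (WordType.cls (t.U.part (t.ι.hull (A ∪ B)))) =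
      beth K (WordType.cls (t.U.part (t.ι.hull A))) *
        beth K (WordType.cls (t.U.part (t.ι.hull B))) := by
  obtain ⟨M, hM, hU, h1, h2⟩ := t.ι.exists_hull_union h hlt
  rw [hU, part_union _ h1, part_union _ h2, map_mul, map_mul, map_mul, map_mul,
    beth_cls_part_of_finite hM, one_mul]

/-- Only two finite ends of `I` are lost, and `ℶ` ignores them. This is the source of the maps being
mutually inverse. -/
lemma CoiTriple.beth_cls_hull_hull (t : CoiTriple G K) {I : Set t.W.Idx} (hI : I.OrdConnected) :
    beth G (WordType.cls (t.W.part (t.ι.symm.hull (t.ι.hull I)))) =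
      beth G (WordType.cls (t.W.part I)) := by
  obtain ⟨A, C, hA, hC, hAd, hCd, hU, h1, h2⟩ := exists_ordConnected_split
    (t.ι.symm.hull_ordConnected (t.ι.hull I)) hI (t.ι.hull_symm_hull_subset hI)
  have key : ∀ S : Set t.W.Idx, S.OrdConnected → S ⊆ I →
      Disjoint S (t.ι.symm.hull (t.ι.hull I)) → S.Finite := fun S hS hSI hd =>
    t.ι.close_dom.finite hS (Set.disjoint_left.2 fun x hx hx' =>
      Set.disjoint_left.1 hd hx (t.ι.mem_hull_symm_hull (hSI hx) hx'))
  have hAf := key A hA (by rw [hU]; exact Set.subset_union_left) hAd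
  have hCf := key C hC (by
    rw [hU]; exact Set.subset_union_right.trans Set.subset_union_right) hCd
  conv_rhs => rw [hU, part_union _ h1, part_union _ h2, map_mul, map_mul, map_mul, map_mul,
    beth_cls_part_of_finite hAf, beth_cls_part_of_finite hCf, one_mul, mul_one]

lemma PartValue.eq_one {m : WordType G} {a : Arch K} (h : PartValue T m a) (hm : m = 1) :
    a = 1 := by
  obtain ⟨x, I, -, rfl, rfl⟩ := h
  obtain rfl := part_eq_one_iff.1 hm
  exact beth_cls_part_of_finite ((T x).ι.hull_subsingleton Set.subsingleton_empty).finite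

lemma PartValue.eq_one_of_single {n : ℕ} {g : G n} {a : Arch K} (h : PartValue T (single g) a) :
    a = 1 := by
  obtain ⟨x, I, -, hm, rfl⟩ := h
  obtain ⟨i, rfl, -⟩ := exists_eq_of_part_eq_single hm.symm
  exact beth_cls_part_of_finite ((T x).ι.hull_subsingleton Set.subsingleton_singleton).finite

lemma PartValue.mem_fineLetters {n : ℕ} {g : G n} {a : Arch K} (h : PartValue T (single g) a) :
    g ∈ fineLetters (fun x => (T x).W) n := by
  obtain ⟨x, I, -, hm, rfl⟩ := h
  obtain ⟨i, -, hi⟩ := exists_eq_of_part_eq_single hm.symm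
  exact mem_fineLetters_of_letter (W := fun x => (T x).W) hi

lemma PartValue.split {m₁ m₂ : WordType G} {a : Arch K} (h : PartValue T (m₁ * m₂) a) :
    ∃ a₁ a₂, PartValue T m₁ a₁ ∧ PartValue T m₂ a₂ ∧ a = a₁ * a₂ := by
  obtain ⟨x, I, hI, hm, rfl⟩ := h
  obtain ⟨A, B, rfl, hlt, rfl, rfl⟩ := part_eq_mul hm.symm
  refine ⟨_, _, ⟨x, A, ⟨fun a ha b hb c hc => ?_⟩, rfl, rfl⟩,
    ⟨x, B, ⟨fun a ha b hb c hc => ?_⟩, rfl, rfl⟩, Coi.beth_cls_hull_union (T x) hI hlt⟩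
  · exact (hI.out (Or.inl ha) (Or.inl hb) hc).resolve_right fun h => (hlt b hb c h).not_ge hc.2
  · exact (hI.out (Or.inr ha) (Or.inr hb) hc).resolve_left fun h => (hlt c h a ha).not_ge hc.1

lemma PartValue.isReduced {m : WordType G} {a : Arch K} (h : PartValue T m a) : m.IsReduced := by
  obtain ⟨x, I, hI, rfl, -⟩ := h
  obtain ⟨b, c, hbc⟩ := exists_type_eq_mul_part hI
  exact IsReduced.factor (hbc ▸ Word.isReduced_iff.1 (T x).reduced_W)

/-- Coherence enters here with sign `1`, and in `PartValue.unique_inv` with sign `-1`. -/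
lemma PartValue.unique (hT : HalfCoherent T) {m : WordType G} {a b : Arch K}
    (ha : PartValue T m a) (hb : PartValue T m b) : a = b := by
  obtain ⟨x, I, hI, rfl, rfl⟩ := ha
  obtain ⟨y, J, hJ, h, rfl⟩ := hb
  have := hT x y I J 1 hI hJ (by simpa [signed] using type_eq_iff.1 h)
  rwa [signed, if_pos rfl] at this

lemma PartValue.unique_inv (hT : HalfCoherent T) {m : WordType G} {a b : Arch K}
    (ha : PartValue T m a) (hb : PartValue T m⁻¹ b⁻¹) : a = b := by
  obtain ⟨x, I, hI, rfl, rfl⟩ := ha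
  obtain ⟨y, J, hJ, h, h'⟩ := hb
  rw [inv_eq_iff_eq_inv] at h'
  have hne : (-1 : ℤˣ) ≠ 1 := by decide
  have := hT x y I J (-1) hI hJ (by
    rw [signed, if_neg hne]
    exact type_eq_iff.1 ((inv_eq_iff_eq_inv.1 h).trans (type_inv _).symm))
  rw [signed, if_neg hne] at this
  exact this.trans h'.symm

lemma FactorValue.inv {m : WordType G} {a : Arch K} (h : FactorValue T m a) :
    FactorValue T m⁻¹ a⁻¹ := by
  rcases h with ⟨rfl, rfl⟩ | ⟨n, g, hg, rfl, rfl⟩ | h | h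
  · exact Or.inl ⟨inv_one, inv_one⟩
  · exact Or.inr (Or.inl ⟨n, g⁻¹, inv_mem_fineLetters hg, single_inv g, inv_one⟩)
  · exact Or.inr (Or.inr (Or.inr (by rwa [inv_inv, inv_inv])))
  · exact Or.inr (Or.inr (Or.inl h))

lemma FactorValue.eq_one {m : WordType G} {a : Arch K} (h : FactorValue T m a) (hm : m = 1) :
    a = 1 := by
  rcases h with ⟨-, rfl⟩ | ⟨n, g, hg, -, rfl⟩ | h | h
  · rfl
  · rfl
  · exact h.eq_one hm
  · exact inv_eq_one.1 (h.eq_one (by rw [hm, inv_one]))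

lemma FactorValue.eq_one_of_single {n : ℕ} {g : G n} {a : Arch K}
    (h : FactorValue T (single g) a) : a = 1 := by
  rcases h with ⟨-, rfl⟩ | ⟨n, g, hg, -, rfl⟩ | h | h
  · rfl
  · rfl
  · exact h.eq_one_of_single
  · rw [single_inv] at h
    exact inv_eq_one.1 h.eq_one_of_single

lemma FactorValue.mem_fineLetters {n : ℕ} {g : G n} {a : Arch K} (hg : g ≠ 1)
    (h : FactorValue T (single g) a) : g ∈ fineLetters (fun x => (T x).W) n := by
  rcases h with ⟨h, -⟩ | ⟨m, k, hk, h, rfl⟩ | h | h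
  · exact absurd h (single_ne_one g)
  · obtain rfl := index_eq_of_single_eq hg h
    rwa [single_injective h]
  · exact h.mem_fineLetters
  · rw [single_inv] at h
    rw [← inv_inv g]
    exact inv_mem_fineLetters h.mem_fineLetters

lemma FactorValue.unique (hT : HalfCoherent T) {m : WordType G} {a b : Arch K}
    (ha : FactorValue T m a) (hb : FactorValue T m b) : a = b := by
  by_cases h1 : m = 1
  · rw [ha.eq_one h1, hb.eq_one h1]
  by_cases h2 : ∃ n, ∃ g : G n, m = single g
  · obtain ⟨n, g, rfl⟩ := h2
    rw [ha.eq_one_of_single, hb.eq_one_of_single]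
  -- A word of length at least two can only have its value as a subword of some `W_x` or `W_x⁻¹`.
  have key : ∀ {a}, FactorValue T m a → PartValue T m a ∨ PartValue T m⁻¹ a⁻¹ := fun h =>
    (h.resolve_left fun h => h1 h.1).resolve_left fun ⟨n, g, _, h, _⟩ => h2 ⟨n, g, h⟩
  rcases key ha with ha | ha <;> rcases key hb with hb | hb
  · exact ha.unique hT hb
  · exact ha.unique_inv hT hb
  · exact (hb.unique_inv hT ha).symm
  · exact inv_injective (ha.unique hT hb)

lemma FactorValue.split {m₁ m₂ : WordType G} {a : Arch K} (h : FactorValue T (m₁ * m₂) a) :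
    ∃ a₁ a₂, FactorValue T m₁ a₁ ∧ FactorValue T m₂ a₂ ∧ a = a₁ * a₂ := by
  rcases h with ⟨h, rfl⟩ | ⟨n, g, hg, h, rfl⟩ | h | h
  · obtain ⟨rfl, rfl⟩ := mul_eq_one_iff.1 h
    exact ⟨1, 1, Or.inl ⟨rfl, rfl⟩, Or.inl ⟨rfl, rfl⟩, (mul_one 1).symm⟩
  · rcases eq_one_or_eq_one_of_single h.symm with rfl | rfl
    · rw [one_mul] at h
      exact ⟨1, 1, Or.inl ⟨rfl, rfl⟩, Or.inr (Or.inl ⟨n, g, hg, h, rfl⟩), (mul_one 1).symm⟩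
    · rw [mul_one] at h
      exact ⟨1, 1, Or.inr (Or.inl ⟨n, g, hg, h, rfl⟩), Or.inl ⟨rfl, rfl⟩, (mul_one 1).symm⟩
  · obtain ⟨a₁, a₂, h₁, h₂, rfl⟩ := h.split
    exact ⟨a₁, a₂, Or.inr (Or.inr (Or.inl h₁)), Or.inr (Or.inr (Or.inl h₂)), rfl⟩
  · rw [mul_inv_rev] at h
    obtain ⟨a₂, a₁, h₂, h₁, h'⟩ := h.split
    refine ⟨a₁⁻¹, a₂⁻¹, Or.inr (Or.inr (Or.inr ?_)), Or.inr (Or.inr (Or.inr ?_)), ?_⟩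
    · rwa [inv_inv]
    · rwa [inv_inv]
    · rw [← inv_inv a, h', mul_inv_rev]

/-- The one exception is the letter `1`, which arises because a product of letters of one group may
be trivial. -/
lemma FactorValue.exists_isReduced {m : WordType G} {a : Arch K} (h : FactorValue T m a) :
    m.IsReduced ∨ (cls m = 1 ∧ a = 1) := by
  rcases h with ⟨rfl, rfl⟩ | ⟨n, g, hg, rfl, rfl⟩ | h | h
  · exact Or.inl isReduced_one
  · by_cases h1 : g = 1
    · subst h1
      exact Or.inr ⟨cls_single_one, rfl⟩
    · exact Or.inl (isReduced_single h1)
  · exact Or.inl h.isReduced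
  · exact Or.inl (by simpa using h.isReduced.inv)

namespace HasValue

lemma of_factorValue {m : WordType G} {a : Arch K} (h : FactorValue T m a) : HasValue T m a := by
  simpa using HasValue.cons h .one

lemma mul {m r : WordType G} {a b : Arch K} (h : HasValue T m a) (hr : HasValue T r b) :
    HasValue T (m * r) (a * b) := by
  induction h with
  | one => simpa using hr
  | cons h _ ih =>
    rw [mul_assoc, mul_assoc]
    exact .cons h ih

lemma inv {m : WordType G} {a : Arch K} (h : HasValue T m a) : HasValue T m⁻¹ a⁻¹ := by
  induction h with
  | one => simpa using HasValue.one
  | cons h _ ih =>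
    rw [mul_inv_rev, mul_inv_rev]
    exact ih.mul (of_factorValue h.inv)

/-- The cut passes through one factor of the decomposition or between two; the factor that it meets
is split by `FactorValue.split`. -/
lemma split {m₁ m₂ : WordType G} {a : Arch K} (h : HasValue T (m₁ * m₂) a) :
    ∃ a₁ a₂, HasValue T m₁ a₁ ∧ HasValue T m₂ a₂ ∧ a = a₁ * a₂ := by
  generalize hm : m₁ * m₂ = m at h
  induction h generalizing m₁ with
  | one =>
    obtain ⟨rfl, rfl⟩ := mul_eq_one_iff.1 hm
    exact ⟨1, 1, .one, .one, (mul_one 1).symm⟩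
  | cons h hr ih =>
    rcases exists_of_mul_eq_mul hm with ⟨t, rfl, rfl⟩ | ⟨t, rfl, rfl⟩
    · obtain ⟨b₁, b₂, h₁, h₂, rfl⟩ := h.split
      exact ⟨b₁, _, of_factorValue h₁, .cons h₂ hr, mul_assoc _ _ _⟩
    · obtain ⟨b₁, b₂, h₁, h₂, rfl⟩ := ih rfl
      exact ⟨_, b₂, .cons h h₁, h₂, (mul_assoc _ _ _).symm⟩

lemma eq_one {m : WordType G} {a : Arch K} (h : HasValue T m a) (hm : m = 1) : a = 1 := by
  induction h with
  | one => rfl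
  | cons h _ ih =>
    obtain ⟨h1, h2⟩ := mul_eq_one_iff.1 hm
    rw [h.eq_one h1, ih h2, one_mul]

lemma factorValue_of_single {n : ℕ} {g : G n} {a : Arch K} (h : HasValue T (single g) a) :
    FactorValue T (single g) a := by
  generalize hm : single g = m at h
  induction h with
  | one => exact absurd hm (single_ne_one g)
  | cons h hr ih =>
    rcases eq_one_or_eq_one_of_single hm with rfl | rfl
    · rw [h.eq_one rfl, one_mul, one_mul]
      exact ih (by rw [hm, one_mul])
    · rwa [hr.eq_one rfl, mul_one, mul_one]

lemma eq_of_factorValue (hT : HalfCoherent T) {m : WordType G} {a b : Arch K}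
    (h : HasValue T m a) (hb : FactorValue T m b) : b = a := by
  induction h generalizing b with
  | one => exact hb.eq_one rfl
  | cons h _ ih =>
    obtain ⟨b₁, b₂, h₁, h₂, rfl⟩ := hb.split
    rw [h₁.unique hT h, ih h₂]

/-- Cut the second decomposition along the factors of the first, one at a time. Each factor is then
itself cut along the pieces found in it (`eq_of_factorValue`), which amounts to a common refinement.
-/
lemma unique (hT : HalfCoherent T) {m : WordType G} {a b : Arch K}
    (h : HasValue T m a) (hb : HasValue T m b) : a = b := by
  induction h generalizing b with
  | one => exact (hb.eq_one rfl).symm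
  | cons h _ ih =>
    obtain ⟨b₁, b₂, h₁, h₂, rfl⟩ := hb.split
    rw [h₁.eq_of_factorValue hT h, ih h₂]

/-- The merging step is the reason for admitting letters that are products of occurring letters: `g
* k` need not occur in any `W_x`. -/
lemma exists_mul (hT : HalfCoherent T) {m r : WordType G} {a b : Arch K} (hm : m.IsReduced)
    (hr : r.IsReduced) (ha : HasValue T m a) (hb : HasValue T r b) :
    ∃ s, s.IsReduced ∧ cls s = cls (m * r) ∧ HasValue T s (a * b) := by
  obtain ⟨m', r', c, rfl, rfl, h⟩ := hm.exists_cancel hr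
  obtain ⟨a₁, a₂, ha₁, ha₂, rfl⟩ := ha.split
  obtain ⟨b₁, b₂, hb₁, hb₂, rfl⟩ := hb.split
  -- The cancelled segments `c` and `c⁻¹` have inverse values, which vanish from the product.
  obtain rfl := hb₁.unique hT ha₂.inv
  have hcls : cls (m' * r') = cls (m' * c * (c⁻¹ * r')) := by
    simp only [map_mul, cls_inv]
    group
  have hval : a₁ * a₂ * (a₂⁻¹ * b₂) = a₁ * b₂ := by group
  rw [hval, ← hcls]
  rcases h with h | ⟨m₁, r₁, n, g, k, rfl, rfl, h⟩
  · exact ⟨m' * r', h, rfl, ha₁.mul hb₂⟩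
  · obtain ⟨u, u', hu, hu', rfl⟩ := ha₁.split
    obtain ⟨w', w, hw', hw, rfl⟩ := hb₂.split
    have hgv := hu'.factorValue_of_single
    have hkv := hw'.factorValue_of_single
    have hg := hgv.mem_fineLetters hm.left.right.letter_ne_one
    have hk := hkv.mem_fineLetters hr.right.left.letter_ne_one
    refine ⟨m₁ * single (g * k) * r₁, h, ?_, ?_⟩
    · simp only [map_mul, cls_single_mul, mul_assoc]
    · have := (hu.mul (of_factorValue (Or.inr (Or.inl
        ⟨n, g * k, mul_mem_fineLetters hg hk, rfl, rfl⟩)))).mul hw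
      rwa [hgv.eq_one_of_single, hkv.eq_one_of_single, mul_one, one_mul, ← mul_one u]

/-- Passing to the reduced form does not change the value. -/
lemma exists_isReduced (hT : HalfCoherent T) {m : WordType G} {a : Arch K} (h : HasValue T m a) :
    ∃ s, s.IsReduced ∧ cls s = cls m ∧ HasValue T s a := by
  induction h with
  | one => exact ⟨1, isReduced_one, rfl, .one⟩
  | cons h _ ih =>
    obtain ⟨s, hs, hcls, hv⟩ := ih
    rcases h.exists_isReduced with h' | ⟨h1, rfl⟩
    · obtain ⟨t, ht, hcls', hv'⟩ := exists_mul hT h' hs (of_factorValue h) hv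
      exact ⟨t, ht, by rw [hcls', map_mul, map_mul, hcls], hv'⟩
    · exact ⟨s, hs, by rw [map_mul, h1, one_mul, hcls], by rwa [one_mul]⟩

/-- Both words reduce without change of value, and to the same reduced word. -/
lemma unique_of_cls (hT : HalfCoherent T) {m r : WordType G} {a b : Arch K}
    (ha : HasValue T m a) (hb : HasValue T r b) (h : cls m = cls r) : a = b := by
  obtain ⟨s, hs, hcls, hv⟩ := ha.exists_isReduced hT
  obtain ⟨t, ht, hcls', hv'⟩ := hb.exists_isReduced hT
  obtain rfl := hs.eq_of_cls_eq ht (by rw [hcls, hcls', h])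
  exact hv.unique hT hv'

/-- Only finitely many letters are deleted, and each contributes `1`; they are removed one at a
time. -/
lemma delete (N : ℕ) {m : WordType G} {a : Arch K} (h : HasValue T m a) :
    HasValue T (m.delete N) a := by
  induction hk : (letters N m).length generalizing m a with
  | zero => rwa [delete_eq_self (List.length_eq_zero_iff.1 hk)]
  | succ k ih =>
    obtain ⟨p, q, n, g, hn, rfl, hp⟩ := exists_first_letter (N := N) (m := m)
      (fun h => by simp [h] at hk)
    obtain ⟨a₁, b, h₁, hb, rfl⟩ := h.split
    obtain ⟨a₂, a₃, h₂, h₃, rfl⟩ := hb.split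
    rw [h₂.factorValue_of_single.eq_one_of_single, one_mul]
    have := ih (h₁.mul h₃) (by simpa [hp, letters_single_of_le hn] using hk)
    rwa [delete_mul, delete_mul, delete_single hn, one_mul, ← delete_mul]

/-- After a suitable deletion, which preserves the value, the word represents the same element as
the empty word, whose value is `1`. -/
lemma eq_one_of_beth (hT : HalfCoherent T) {m : WordType G} {a : Arch K} (h : HasValue T m a)
    (hm : beth G (cls m) = 1) : a = 1 := by
  obtain ⟨N, hN⟩ := exists_cls_delete_eq_one hm
  exact (h.delete N).unique_of_cls hT .one (by rw [hN, map_one])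

lemma cls_mem_fine {m : WordType G} {a : Arch K} (h : HasValue T m a) : cls m ∈ fineW T := by
  induction h with
  | one => exact one_mem _
  | cons h _ ih =>
    rw [map_mul]
    refine mul_mem ?_ ih
    rcases h with ⟨rfl, -⟩ | ⟨n, g, hg, rfl, -⟩ | ⟨x, I, hI, rfl, -⟩ | ⟨x, I, hI, hm, -⟩
    · exact one_mem _
    · exact cls_single_mem_fine hg
    · exact cls_part_mem_fine (W := fun x => (T x).W) hI
    · rw [← inv_mem_iff, ← cls_inv, hm]
      exact cls_part_mem_fine (W := fun x => (T x).W) hI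

lemma exists_of_mem_fine {g : TopProd G} (h : g ∈ fineW T) :
    ∃ m a, cls m = g ∧ HasValue T m a := by
  induction h using Subgroup.closure_induction with
  | mem g h =>
    obtain ⟨x, V, ⟨I, hI, hV⟩, rfl⟩ := h
    refine ⟨V.type, _, rfl, of_factorValue (Or.inr (Or.inr (Or.inl ⟨x, I, hI, ?_, rfl⟩)))⟩
    exact type_eq_iff.2 hV
  | one => exact ⟨1, 1, map_one _, .one⟩
  | mul g h _ _ hg hh =>
    obtain ⟨m, a, rfl, hm⟩ := hg
    obtain ⟨r, b, rfl, hr⟩ := hh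
    exact ⟨m * r, a * b, map_mul _ _ _, hm.mul hr⟩
  | inv g _ hg =>
    obtain ⟨m, a, rfl, hm⟩ := hg
    exact ⟨m⁻¹, a⁻¹, cls_inv _, hm.inv⟩

/-- A value for the collection is represented by a word having a value for the inverse
collection, and that value is the class of the original word. -/
lemma exists_symm {m : WordType G} {a : Arch K} (h : HasValue T m a) :
    ∃ r, HasValue (fun x => (T x).symm) r (beth G (cls m)) ∧ beth K (cls r) = a := by
  have key : ∀ {m a}, PartValue T m a →
      ∃ r, PartValue (fun x => (T x).symm) r (beth G (cls m)) ∧ beth K (cls r) = a := by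
    rintro _ _ ⟨x, I, hI, rfl, rfl⟩
    -- The subword of `U_x` on the hull of `I` represents the value, and its own value is computed
    -- on the double hull, which is `I` up to finite ends.
    exact ⟨_, ⟨x, (T x).ι.hull I, (T x).ι.hull_ordConnected I, rfl,
      ((T x).beth_cls_hull_hull hI).symm⟩, rfl⟩
  induction h with
  | one => exact ⟨1, by simpa using HasValue.one, by simp⟩
  | @cons m _ a _ h _ ih =>
    have hf : ∃ r, FactorValue (fun x => (T x).symm) r (beth G (cls m)) ∧
        beth K (cls r) = a := by
      rcases h with ⟨rfl, rfl⟩ | ⟨n, g, hg, rfl, rfl⟩ | h | h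
      · exact ⟨1, Or.inl ⟨rfl, by simp⟩, by simp⟩
      -- A single letter is trivial under `ℶ` and has value `1`, so the empty word serves.
      · exact ⟨1, Or.inl ⟨rfl, beth_cls_single g⟩, by simp⟩
      · obtain ⟨r, hr, hr'⟩ := key h
        exact ⟨r, Or.inr (Or.inr (Or.inl hr)), hr'⟩
      · obtain ⟨r, hr, hr'⟩ := key h
        refine ⟨r⁻¹, Or.inr (Or.inr (Or.inr ?_)), ?_⟩
        · rwa [inv_inv, ← map_inv, ← cls_inv]
        · rw [cls_inv, map_inv, hr', inv_inv]
    obtain ⟨r, hr, rfl⟩ := hf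
    obtain ⟨s, hs, rfl⟩ := ih
    exact ⟨r * s, by rw [map_mul, map_mul]; exact .cons hr hs, by simp⟩

end HasValue

end Values

/-! ## The induced homomorphisms -/

section Induced

variable {G : ℕ → Type u} {K : ℕ → Type v} [∀ n, Group (G n)] [∀ n, Group (K n)] {X : Type w}

open Word hiding cls single letters
open WordType

lemma Word.part_inv (W : Word G) (S : Set W.Idxᵒᵈ) :
    W.inv.part S = (W.part (OrderDual.toDual ⁻¹' S))⁻¹ := by
  refine type_eq_iff.2 ⟨⟨⟨fun i => OrderDual.toDual ⟨OrderDual.ofDual i.1, i.2⟩,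
    fun i => ⟨OrderDual.toDual (OrderDual.ofDual i).1, (OrderDual.ofDual i).2⟩,
    fun _ => rfl, fun _ => rfl⟩, Iff.rfl⟩, fun _ => rfl⟩

variable {T : X → CoiTriple G K}

lemma FactorValue.of_equiv {V : Word G} {a : Arch K} {x : X} {I : Set (T x).W.Idx} {δ : ℤˣ}
    (hI : I.OrdConnected) (hV : V.Equiv (((T x).W.restrict I).signed δ))
    (ha : a = (((T x).U.restrict ((T x).ι.hull I)).signed δ).dcls) : FactorValue T V.type a := by
  rw [signed] at hV ha
  split_ifs at hV ha
  · exact Or.inr (Or.inr (Or.inl ⟨x, I, hI, type_eq_iff.2 hV, ha⟩))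
  · refine Or.inr (Or.inr (Or.inr ⟨x, I, hI, inv_eq_iff_eq_inv.2 (type_eq_iff.2 hV), ?_⟩))
    rw [inv_eq_iff_eq_inv, ← map_inv]
    exact ha

lemma exists_factorValue_of_isSubword {V : Word G} {x : X} {δ : ℤˣ}
    (h : V.IsSubword ((T x).W.signed δ)) : ∃ a, FactorValue T V.type a := by
  rw [signed] at h
  split_ifs at h
  · obtain ⟨I, hI, hV⟩ := h
    exact ⟨_, Or.inr (Or.inr (Or.inl ⟨x, I, hI, type_eq_iff.2 hV, rfl⟩))⟩
  · obtain ⟨I, hI, hV⟩ := h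
    refine ⟨_, Or.inr (Or.inr (Or.inr
      ⟨x, OrderDual.toDual ⁻¹' I, hI.dual, ?_, inv_inv _⟩))⟩
    rw [inv_eq_iff_eq_inv]
    exact (type_eq_iff.2 hV).trans (part_inv (T x).W I)

lemma FactorValue.eq_one_of_subsingleton {V : Word G} [Subsingleton V.Idx] {a : Arch K}
    (h : FactorValue T V.type a) : a = 1 := by
  rcases isEmpty_or_nonempty V.Idx with hV | ⟨⟨i⟩⟩
  · exact h.eq_one (type_eq_one_iff.2 hV)
  · obtain ⟨n, g, hg⟩ := V.isLetter i
    rw [type_eq_single (fun j => Subsingleton.elim j i) hg.symm] at h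
    exact h.eq_one_of_single

/-- An omitted one-letter subword also has a contribution as a subword; that contribution is `1`, so
the convention of omission agrees with it. -/
lemma IsFinePiece.factorValue {V : Word G} (h : IsFinePiece (fun x => (T x).W) V) {a : Arch K}
    (ha : PieceValue T V a) : FactorValue T V.type a := by
  rcases ha with ⟨hs, rfl⟩ | ⟨-, x, I, δ, hI, hV, ha⟩
  · rcases h with ⟨-, x, δ, hV⟩ | ⟨i, hi, -, n, ⟨g, hg⟩, hn⟩
    · obtain ⟨b, hb⟩ := exists_factorValue_of_isSubword hV
      rwa [hb.eq_one_of_subsingleton] at hb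
    · refine Or.inr (Or.inl ⟨n, g, ?_, type_eq_single hi hg.symm, rfl⟩)
      rwa [← hg] at hn
  · exact FactorValue.of_equiv hI hV ha

lemma HasValue.of_forall₂ {L : List (Word G)} {A : List (Arch K)}
    (hL : ∀ V ∈ L, IsFinePiece (fun x => (T x).W) V) (h : List.Forall₂ (PieceValue T) L A) :
    HasValue T (concatList L).type A.prod := by
  induction h with
  | nil => exact .one
  | cons h _ ih =>
    rw [List.forall_mem_cons] at hL
    rw [List.prod_cons]
    exact .cons (hL.1.factorValue h) (ih hL.2)

/-- A factor with a value is empty or is one of the factors allowed in a decomposition. -/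
lemma FactorValue.exists_word {m : WordType G} {a : Arch K} (h : FactorValue T m a)
    (hm : m.IsReduced) :
    (m = 1 ∧ a = 1) ∨
      ∃ V : Word G, V.type = m ∧ IsFinePiece (fun x => (T x).W) V ∧ PieceValue T V a := by
  by_cases h1 : m = 1
  · exact Or.inl ⟨h1, h.eq_one h1⟩
  refine Or.inr ?_
  have nonempty : ∀ {V : Word G}, V.type = m → Nonempty V.Idx := fun hV => by
    rw [← not_isEmpty_iff, ← type_eq_one_iff, hV]
    exact h1
  have piece : ∀ {V : Word G}, V.type = m → (∃ (x : X) (I : Set (T x).W.Idx) (δ : ℤˣ),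
      I.OrdConnected ∧ V.Equiv (((T x).W.restrict I).signed δ) ∧
      a = (((T x).U.restrict ((T x).ι.hull I)).signed δ).dcls) → PieceValue T V a := by
    rintro V rfl hV
    -- `PieceValue` allows a subword with a single letter only as an omitted factor.
    rcases subsingleton_or_nontrivial V.Idx with hs | hn
    · exact Or.inl ⟨hs, h.eq_one_of_subsingleton⟩
    · exact Or.inr ⟨hn, hV⟩
  rcases h with h | ⟨n, g, hg, rfl, rfl⟩ | ⟨x, I, hI, rfl, rfl⟩ | ⟨x, I, hI, hm', ha⟩
  · exact absurd h.1 h1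
  · have hg1 := hm.letter_ne_one
    exact ⟨Word.single g, rfl, Or.inr ⟨(), fun _ => rfl,
      (map_ne_one_iff _ (CoprodI.of_injective n)).2 hg1, n, of_mem_grp n g, hg⟩,
      Or.inl ⟨inferInstanceAs (Subsingleton Unit), rfl⟩⟩
  · refine ⟨(T x).W.restrict I, rfl, Or.inl ⟨nonempty rfl, x, 1, ?_⟩,
      piece rfl ⟨x, I, 1, hI, ?_, ?_⟩⟩
    · rw [signed, if_pos rfl]
      exact ⟨I, hI, type_eq_iff.1 rfl⟩
    · rw [signed, if_pos rfl]
      exact type_eq_iff.1 rfl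
    · rw [signed, if_pos rfl]
      rfl
  · rw [inv_eq_iff_eq_inv] at hm' ha
    have hne : (-1 : ℤˣ) ≠ 1 := by decide
    refine ⟨((T x).W.restrict I).inv, hm'.symm, Or.inl ⟨nonempty hm'.symm, x, -1, ?_⟩,
      piece hm'.symm ⟨x, I, -1, hI, ?_, ?_⟩⟩
    · rw [signed, if_neg hne]
      exact ⟨OrderDual.ofDual ⁻¹' I, hI.dual, type_eq_iff.1 ((T x).W.part_inv _).symm⟩
    · rw [signed, if_neg hne]
      exact type_eq_iff.1 rfl
    · rw [signed, if_neg hne, ha, ← map_inv]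
      rfl

lemma HasValue.exists_list {m : WordType G} {a : Arch K} (h : HasValue T m a)
    (hm : m.IsReduced) :
    ∃ L : List (Word G), (∀ V ∈ L, IsFinePiece (fun x => (T x).W) V) ∧
      (concatList L).type = m ∧ ∃ A : List (Arch K), List.Forall₂ (PieceValue T) L A ∧
        A.prod = a := by
  induction h with
  | one => exact ⟨[], by simp, rfl, [], .nil, rfl⟩
  | cons h _ ih =>
    obtain ⟨L, hL, rfl, A, hA, rfl⟩ := ih hm.right
    rcases h.exists_word hm.left with ⟨rfl, rfl⟩ | ⟨V, rfl, hV, hV'⟩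
    · exact ⟨L, hL, (one_mul _).symm, A, hA, (one_mul _).symm⟩
    · exact ⟨V :: L, List.forall_mem_cons.2 ⟨hV, hL⟩, rfl, _ :: A, .cons hV' hA,
        List.prod_cons⟩

/-- The recipe requires a reduced word and nonempty factors, while `HasValue` requires neither.
Reduction preserves the value, and empty factors may be dropped, so nothing is gained or lost. -/
lemma inducedValue_iff (hT : HalfCoherent T) {g : TopProd G} {a : Arch K} :
    InducedValue T g a ↔ ∃ m, cls m = g ∧ HasValue T m a := by
  constructor
  · rintro ⟨W, -, rfl, L, hL, hW, A, hA, rfl⟩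
    exact ⟨(concatList L).type, congrArg cls (type_eq_iff.2 hW).symm, .of_forall₂ hL hA⟩
  · rintro ⟨m, rfl, h⟩
    obtain ⟨s, hs, hcls, hv⟩ := h.exists_isReduced hT
    obtain ⟨W, rfl⟩ := s.exists_word
    obtain ⟨L, hL, hLs, hA⟩ := hv.exists_list hs
    exact ⟨W, Word.isReduced_iff.2 hs, hcls, L, hL, type_eq_iff.1 hLs.symm, hA⟩

/-- Since values are defined for unreduced words, multiplicativity is mere concatenation of
decompositions. -/
lemma HalfCoherent.exists_hom (hT : HalfCoherent T) :
    ∃ φ : fineW T →* Arch K, ∀ g a, φ g = a ↔ ∃ m, cls m = (g : TopProd G) ∧ HasValue T m a := by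
  have ex : ∀ g : fineW T, ∃ a m, cls m = (g : TopProd G) ∧ HasValue T m a := fun g => by
    obtain ⟨m, a, h⟩ := HasValue.exists_of_mem_fine g.2
    exact ⟨a, m, h⟩
  choose φ hφ using ex
  have spec : ∀ g a, φ g = a ↔ ∃ m, cls m = (g : TopProd G) ∧ HasValue T m a := by
    refine fun g a => ⟨fun h => h ▸ hφ g, ?_⟩
    rintro ⟨m, hm, h⟩
    obtain ⟨r, hr, h'⟩ := hφ g
    exact h'.unique_of_cls hT h (hr.trans hm.symm)
  refine ⟨MonoidHom.mk' φ fun g h => ?_, spec⟩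
  obtain ⟨m, hm, hv⟩ := hφ g
  obtain ⟨r, hr, hv'⟩ := hφ h
  exact (spec _ _).2 ⟨m * r, by rw [map_mul, hm, hr]; rfl, hv.mul hv'⟩

end Induced

/-- Two homomorphisms that are inverse to each other modulo `p` and `q` descend to mutually inverse
isomorphisms. -/
lemma exists_mulEquiv_map {A B A' B' : Type*} [Group A] [Group B] [Group A'] [Group B']
    {H : Subgroup A} {L : Subgroup B} (p : A →* A') (q : B →* B') (f : H →* B') (k : L →* A')
    (hf : ∀ g : H, ∃ h : L, q h = f g ∧ k h = p g) (hk : ∀ h : L, ∃ g : H, p g = k h ∧ f g = q h)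
    (hf' : ∀ g : H, p g = 1 → f g = 1) (hk' : ∀ h : L, q h = 1 → k h = 1) :
    ∃ Φ : H.map p ≃* L.map q,
      (∀ g : H, (Φ ⟨p g, Subgroup.mem_map_of_mem p g.2⟩ : B') = f g) ∧
      ∀ h : L, (Φ.symm ⟨q h, Subgroup.mem_map_of_mem q h.2⟩ : A') = k h := by
  have hfc : ∀ g g' : H, p g = p g' → f g = f g' := fun g g' h => by
    rw [← inv_mul_eq_one, ← map_inv, ← map_mul]
    exact hf' _ (by simp [h])
  have hkc : ∀ g g' : L, q g = q g' → k g = k g' := fun g g' h => by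
    rw [← inv_mul_eq_one, ← map_inv, ← map_mul]
    exact hk' _ (by simp [h])
  have hs : ∀ y : H.map p, ∃ g : H, p g = y := fun ⟨y, g, hg, h⟩ => ⟨⟨g, hg⟩, h⟩
  have ht : ∀ z : L.map q, ∃ h : L, q h = z := fun ⟨z, g, hg, h⟩ => ⟨⟨g, hg⟩, h⟩
  -- The choice of preimages is immaterial: by `hfc` and `hkc` the values of `f` and `k` depend only
  -- on the images under `p` and `q`.
  choose s hs using hs
  choose t ht using ht
  refine ⟨{
    toFun := fun y => ⟨f (s y), ?_⟩
    invFun := fun z => ⟨k (t z), ?_⟩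
    left_inv := fun y => Subtype.ext ?_
    right_inv := fun z => Subtype.ext ?_
    map_mul' := fun y y' => Subtype.ext ?_ }, fun g => ?_, fun h => ?_⟩
  · obtain ⟨h, hh, -⟩ := hf (s y)
    exact ⟨h, h.2, hh⟩
  · obtain ⟨g, hg, -⟩ := hk (t z)
    exact ⟨g, g.2, hg⟩
  · obtain ⟨h, hh, hh'⟩ := hf (s y)
    exact (hkc _ h ((ht _).trans hh.symm)).trans (hh'.trans (hs y))
  · obtain ⟨g, hg, hg'⟩ := hk (t z)
    exact (hfc _ g ((hs _).trans hg.symm)).trans (hg'.trans (ht z))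
  · refine (hfc _ (s y * s y') ?_).trans (map_mul f _ _)
    rw [hs, Subgroup.coe_mul, Subgroup.coe_mul, map_mul, hs, hs]
  · exact hfc _ _ (hs _)
  · exact hkc _ _ (ht _)

/-! ### Passage to the images under `ℶ` -/

section Isomorphism

variable {G : ℕ → Type u} {K : ℕ → Type v} [∀ n, Group (G n)] [∀ n, Group (K n)] {X : Type w}

open WordType

/-- This places the values of `φ` in `ℶ(Fine({U_x}))` and, at the same time, shows that `ψ` undoes
`φ` modulo `ℶ`. -/
lemma exists_symm_value {T : X → CoiTriple G K}
    {φ : fineW T →* Arch K} {ψ : fineU T →* Arch G}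
    (hφ : ∀ g a, φ g = a ↔ ∃ m, cls m = (g : TopProd G) ∧ HasValue T m a)
    (hψ : ∀ h b, ψ h = b ↔ ∃ m, cls m = (h : TopProd K) ∧ HasValue (fun x => (T x).symm) m b)
    (g : fineW T) : ∃ h : fineU T, beth K h = φ g ∧ ψ h = beth G g := by
  obtain ⟨m, hm, hv⟩ := (hφ g _).1 rfl
  obtain ⟨r, hr, hr'⟩ := hv.exists_symm
  exact ⟨⟨cls r, hr.cls_mem_fine⟩, hr', (hψ _ _).2 ⟨r, rfl, by rwa [← hm]⟩⟩

lemma eq_one_of_beth_eq_one {T : X → CoiTriple G K} (hT : HalfCoherent T)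
    {φ : fineW T →* Arch K}
    (hφ : ∀ g a, φ g = a ↔ ∃ m, cls m = (g : TopProd G) ∧ HasValue T m a)
    (g : fineW T) (hg : beth G g = 1) : φ g = 1 := by
  obtain ⟨m, hm, hv⟩ := (hφ g _).1 rfl
  exact hv.eq_one_of_beth hT (by rwa [hm])

end Isomorphism

end InfiniteWords

end

open InfiniteWords in
theorem mainTheorem2 {G : ℕ → Type u} {K : ℕ → Type v} [∀ n, Group (G n)] [∀ n, Group (K n)]
    {X : Type w} (T : X → CoiTriple G K) (hT : Coherent T) :
    ∃ (φ₀ : fineW T →* Arch K) (φ₁ : fineU T →* Arch G),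
      (∀ g a, φ₀ g = a ↔ InducedValue T g a) ∧
      (∀ h b, φ₁ h = b ↔ InducedValue (fun x => (T x).symm) h b) ∧
      ∃ (Φ₀ : (fineW T).map (beth G) ≃* (fineU T).map (beth K))
        (Φ₁ : (fineU T).map (beth K) ≃* (fineW T).map (beth G)),
        (∀ g : fineW T, (Φ₀ ⟨beth G g, Subgroup.mem_map_of_mem (beth G) g.2⟩ : Arch K) = φ₀ g) ∧
        (∀ h : fineU T, (Φ₁ ⟨beth K h, Subgroup.mem_map_of_mem (beth K) h.2⟩ : Arch G) = φ₁ h) ∧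
        Φ₁ = Φ₀.symm := by
  obtain ⟨φ₀, h₀⟩ := hT.1.exists_hom
  obtain ⟨φ₁, h₁⟩ : ∃ φ : fineU T →* Arch G, ∀ h b, φ h = b ↔
      ∃ m, WordType.cls m = (h : TopProd K) ∧ HasValue (fun x => (T x).symm) m b :=
    hT.2.exists_hom
  obtain ⟨Φ, hΦ, hΦ'⟩ := exists_mulEquiv_map (beth G) (beth K) φ₀ φ₁
    (exists_symm_value h₀ h₁) (exists_symm_value (T := fun x => (T x).symm) h₁ h₀)
    (eq_one_of_beth_eq_one hT.1 h₀) (eq_one_of_beth_eq_one hT.2 h₁)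
  exact ⟨φ₀, φ₁, fun g a => (h₀ g a).trans (inducedValue_iff hT.1).symm,
    fun h b => (h₁ h b).trans (inducedValue_iff hT.2).symm, Φ, Φ.symm, hΦ, hΦ', rfl⟩
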